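/- **Setting.** Let $\mathbf V$ be a finite set of random variables. Each $V_i\in\mathbf V$ takes values in a measurable space with a $\sigma$-finite reference measure; densities are taken with respect to the product reference measure, and identities between densities hold almost everywhere. A *causal model* (structural equation model) over $\mathbf V$ is a set of equations, one for each $V_i$, expressing $V_i$ as a function of its causal determinants and of random noise, where the edges $V_j\to V_i$ ($V_j$ a causal determinant of $V_i$) form a directed acyclic graph (DAG) $\mathcal D$. Let $f(\mathbf v\mid do(\mathbf s))$, for $\mathbf S\subseteq\mathbf V$, be the densities of the variables when the variables in $\mathbf S$ are set to $\mathbf s$, with $f(\mathbf v)$ the observational density ($\mathbf S=\emptyset$). It is assumed that $f(\mathbf v)>0$; that the densities are *consistent* with $\mathcal D$, i.e. for all $\mathbf S\subseteq\mathbf V$ $$f(\mathbf v\mid do(\mathbf s))=\prod_{V_i\in\mathbf V\setminus\mathbf S} f\big(v_i\mid \mathrm{pa}(v_i,\mathcal D)\big)\,\mathbb 1(\mathbf S=\mathbf s);$$ and that $f(\mathbf v)$ is *faithful* to $\mathcal D$, i.e. for pairwise disjoint $\mathbf A,\mathbf B,\mathbf C\subseteq\mathbf V$, if $\mathbf A\perp\!\!\!\perp\mathbf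 B\mid\mathbf C$ under $f$, then $\mathbf A$ and $\mathbf B$ are d-separated given $\mathbf C$ in $\mathcal D$. For pairwise disjoint $\mathbf X,\mathbf Y,\mathbf Z\subseteq\mathbf V$, the set $\mathbf Z$ is an *adjustment set* relative to $(\mathbf X,\mathbf Y)$ if $g(\mathbf y\mid do(\mathbf x))=\int g(\mathbf y\mid\mathbf x,\mathbf z)\,g(\mathbf z)\,d\mathbf z$ for every family $g$ of interventional densities (with positive observational density, for any value spaces and reference measures) that is consistent with $\mathcal D$. It is a *minimal adjustment set* if in addition no proper subset of $\mathbf Z$ is an adjustment set relative to $(\mathbf X,\mathbf Y)$. We write $\mathbf T<X$ if $X$ is not an ancestor in $\mathcal D$ of any element of $\mathbf T$. All (in)dependences below refer to the observational density $f$ of the model. **Lemma (Probabilistic criteria for minimality).** Let $\mathbf T$ be an adjustment set relative to $(X,Y)$, for single variables $X,Y$, in a causal model where $\mathbf T<X$. Then $\mathbf T$ is a minimal adjustment set relative to $(X,Y)$ if and only if for all $T\in\mathbf T$, 1. $X\not\!\perp\!\!\!\perp T\mid\mathbf T\setminus\{T\}$, and 2. $Y\not\!\perp\!\!\!\perp T\mid(\mathbf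 T\setminus\{T\})\cup\{X\}$. Otherwise (if $\mathbf T$ is not minimal), a proper subset $\mathbf Z\subset\mathbf T$ is a minimal adjustment set relative to $(X,Y)$ if for all $Z\in\mathbf Z$, 3. $X\not\!\perp\!\!\!\perp Z\mid\mathbf Z\setminus\{Z\}$, and 4. $Y\not\!\perp\!\!\!\perp Z\mid(\mathbf Z\setminus\{Z\})\cup\{X\}$, and, in addition (also when $\mathbf Z=\emptyset$), 5. $Y\perp\!\!\!\perp\mathbf T\mid\mathbf Z\cup\{X\}$ or $X\perp\!\!\!\perp\mathbf T\mid\mathbf Z$. -/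

import Mathlib

open MeasureTheory
open scoped ENNReal

universe v u

/-- A directed acyclic graph on the node set `V`; `D.Adj i j` is the edge `i → j`. -/
structure DAG (V : Type v) extends Digraph V where
  acyclic : ∀ i, ¬ Relation.TransGen Adj i i

namespace DAG

variable {V : Type v} (D : DAG V)

/-- There is a directed path (possibly of length zero) from `i` to `j`. -/
def IsAncestor (i j : V) : Prop := Relation.ReflTransGen D.Adj i j

/-- `S < S'`: no element of `S'` is an ancestor of an element of `S`. -/
def Precedes (S S' : Finset V) : Prop := ∀ i ∈ S, ∀ j ∈ S', ¬ D.IsAncestor j i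

/-- A path: a nonempty sequence of distinct nodes, successive ones joined by an edge in either
direction. -/
structure IsPath (p : List V) : Prop where
  ne_nil : p ≠ []
  nodup : p.Nodup
  chain : p.IsChain (fun i j => D.Adj i j ∨ D.Adj j i)

/-- `p` is a path from the node set `A` to the node set `B`. -/
def IsPathBetween (A B : Finset V) (p : List V) : Prop :=
  D.IsPath p ∧ (∃ a ∈ A, p.head? = some a) ∧ (∃ b ∈ B, p.getLast? = some b)

/-- `… a → b ← c …` occurs on `p`. -/
def IsCollider (p : List V) (b : V) : Prop :=
  ∃ a c, [a, b, c] <:+: p ∧ D.Adj a b ∧ D.Adj c b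

/-- `… a ← b … c …` or `… a … b → c …` occurs on `p`. -/
def IsNonCollider (p : List V) (b : V) : Prop :=
  ∃ a c, [a, b, c] <:+: p ∧ (D.Adj b a ∨ D.Adj b c)

/-- The path `p` is d-connecting given `C`. -/
def IsOpen (p : List V) (C : Finset V) : Prop :=
  (∀ b, D.IsNonCollider p b → b ∉ C) ∧
    (∀ b, D.IsCollider p b → ∃ c ∈ C, D.IsAncestor b c)

/-- `A` and `B` are d-separated given `C`. -/
def DSep (A B C : Finset V) : Prop := ∀ p, D.IsPathBetween A B p → ¬ D.IsOpen p C

open Classical in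
/-- The set of parents of `i`. -/
noncomputable def parents [Fintype V] (i : V) : Finset V :=
  Finset.univ.filter (fun j => D.Adj j i)

theorem wellFounded_adj [Finite V] : WellFounded D.Adj := by
  have : Std.Irrefl (Relation.TransGen D.Adj) := ⟨D.acyclic⟩
  have h : WellFounded (Relation.TransGen D.Adj) := Finite.wellFounded_of_trans_of_irrefl _
  exact Subrelation.wf (fun h => Relation.TransGen.single h) h

end DAG

section Densities

variable {V : Type v} [Fintype V] [DecidableEq V] {Ω : V → Type u}
  [∀ i, MeasurableSpace (Ω i)]

/-- The marginal density of the variables in `S`, as a function of `v` through `(v i)_{i ∈ S}`: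
all other coordinates are integrated out against the reference measures `μ`. -/
noncomputable def marginalDensity (μ : ∀ i, Measure (Ω i)) (f : (∀ i, Ω i) → ℝ≥0∞)
    (S : Finset V) : (∀ i, Ω i) → ℝ≥0∞ :=
  lmarginal μ Sᶜ f

/-- The conditional density `f(a | b)` of the variables in `A` given those in `B`. -/
noncomputable def condDensity (μ : ∀ i, Measure (Ω i)) (f : (∀ i, Ω i) → ℝ≥0∞)
    (A B : Finset V) : (∀ i, Ω i) → ℝ≥0∞ :=
  fun w => marginalDensity μ f (A ∪ B) w / marginalDensity μ f B w

/-- Conditional independence of `A` and `B` given `C` under the joint density `f`: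
`f(a, b, c) f(c) = f(a, c) f(b, c)` almost everywhere. -/
def CondIndepDensity (μ : ∀ i, Measure (Ω i)) (f : (∀ i, Ω i) → ℝ≥0∞)
    (A B C : Finset V) : Prop :=
  ∀ᵐ w ∂Measure.pi μ,
    marginalDensity μ f (A ∪ B ∪ C) w * marginalDensity μ f C w =
      marginalDensity μ f (A ∪ C) w * marginalDensity μ f (B ∪ C) w

/-- `F` is a set of interventional densities with a positive observational density `F ∅`.
For a set `S` of intervened variables, `F S w` is the value at `w` of the density
`f(· | do(S = (w i)_{i ∈ S}))`. The intervened coordinates are held at their prescribed values,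
and the density is one in the remaining coordinates. -/
structure IsInterventionalFamily (μ : ∀ i, Measure (Ω i))
    (F : Finset V → (∀ i, Ω i) → ℝ≥0∞) : Prop where
  measurable : ∀ S, Measurable (F S)
  lintegral_eq_one : ∫⁻ w, F ∅ w ∂Measure.pi μ = 1
  normalized : ∀ S, ∀ᵐ w ∂Measure.pi μ, lmarginal μ Sᶜ (F S) w = 1
  pos : ∀ᵐ w ∂Measure.pi μ, 0 < F ∅ w

/-- `D` is a causal Bayesian network compatible with `F`: every interventional density obeys the
truncated factorization. -/
def DAG.IsCompatible (D : DAG V) (μ : ∀ i, Measure (Ω i))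
    (F : Finset V → (∀ i, Ω i) → ℝ≥0∞) : Prop :=
  ∀ S, ∀ᵐ w ∂Measure.pi μ, F S w = ∏ i ∈ Sᶜ, condDensity μ (F ∅) {i} (D.parents i) w

/-- The density `f` is faithful to `D`. -/
def DAG.IsFaithful (D : DAG V) (μ : ∀ i, Measure (Ω i)) (f : (∀ i, Ω i) → ℝ≥0∞) : Prop :=
  ∀ A B C : Finset V, Disjoint A B → Disjoint A C → Disjoint B C →
    CondIndepDensity μ f A B C → D.DSep A B C

/-- `f(y | do(x)) = ∫ f(y | x, z) f(z) dz` for the interventional densities `F`. -/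
def AdjustmentFormula (μ : ∀ i, Measure (Ω i)) (F : Finset V → (∀ i, Ω i) → ℝ≥0∞)
    (X Y Z : Finset V) : Prop :=
  ∀ᵐ w ∂Measure.pi μ,
    lmarginal μ (X ∪ Y)ᶜ (F X) w =
      lmarginal μ Z
        (fun w' => condDensity μ (F ∅) Y (X ∪ Z) w' * marginalDensity μ (F ∅) Z w') w

end Densities

/-- `Z` is an adjustment set relative to `(X, Y)` in the causal DAG `D`: the adjustment formula
holds for all interventional densities consistent with `D`, whatever the value spaces of the
variables and the reference measures. -/
def IsAdjustmentSet {V : Type v} [Fintype V] [DecidableEq V] (D : DAG V)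
    (X Y Z : Finset V) : Prop :=
  Disjoint X Y ∧ Disjoint X Z ∧ Disjoint Y Z ∧
    ∀ (Ω : V → Type u) [∀ i, MeasurableSpace (Ω i)] (μ : ∀ i, Measure (Ω i))
      [∀ i, SigmaFinite (μ i)] (F : Finset V → (∀ i, Ω i) → ℝ≥0∞),
      IsInterventionalFamily μ F → D.IsCompatible μ F → AdjustmentFormula μ F X Y Z

/-- `Z` is an adjustment set and no proper subset of `Z` is one. -/
def IsMinimalAdjustmentSet {V : Type v} [Fintype V] [DecidableEq V] (D : DAG V)
    (X Y Z : Finset V) : Prop :=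
  IsAdjustmentSet.{v, u} D X Y Z ∧ ∀ Z' ⊂ Z, ¬ IsAdjustmentSet.{v, u} D X Y Z'

/-- A structural equation model with variables `V`: each variable is a function of its causal
determinants (its parents in `D`) and of a random noise. The joint law of the noises is
arbitrary. -/
structure StructuralModel (V : Type v) [Fintype V] (Ω : V → Type u)
    [∀ i, MeasurableSpace (Ω i)] where
  /-- the induced graph -/
  D : DAG V
  /-- the noise spaces -/
  E : V → Type u
  [measurableSpaceE : ∀ i, MeasurableSpace (E i)]
  /-- the joint law of the noises -/
  noise : Measure (∀ i, E i)
  [isProbabilityMeasure_noise : IsProbabilityMeasure noise]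
  /-- the structural equations -/
  eqn : ∀ i, (∀ j : {j // D.Adj j i}, Ω j) × E i → Ω i
  measurable_eqn : ∀ i, Measurable (eqn i)

attribute [instance] StructuralModel.measurableSpaceE
attribute [instance] StructuralModel.isProbabilityMeasure_noise

namespace StructuralModel

variable {V : Type v} [Fintype V] [DecidableEq V] {Ω : V → Type u}
  [∀ i, MeasurableSpace (Ω i)] (M : StructuralModel V Ω)

/-- The solution of the equations for the noise values `e`, under the intervention that sets
the variables in `S` to their values in `x`. -/
noncomputable def solve (S : Finset V) (x : ∀ i, Ω i) (e : ∀ i, M.E i) : ∀ i, Ω i :=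
  M.D.wellFounded_adj.fix
    (fun i ih => if i ∈ S then x i else M.eqn i (fun j => ih j.1 j.2, e i))

theorem solve_eq (S : Finset V) (x : ∀ i, Ω i) (e : ∀ i, M.E i) (i : V) :
    M.solve S x e i =
      if i ∈ S then x i else M.eqn i (fun j => M.solve S x e j.1, e i) := by
  unfold solve
  rw [WellFounded.fix_eq]

theorem measurable_solve (S : Finset V) (x : ∀ i, Ω i) : Measurable (M.solve S x) := by
  refine measurable_pi_iff.2 fun i => ?_
  induction i using M.D.wellFounded_adj.induction with
  | _ i ih =>
    simp only [solve_eq M S x _ i]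
    split_ifs
    · exact measurable_const
    · exact (M.measurable_eqn i).comp
        ((measurable_pi_iff.2 fun j => ih j.1 j.2).prodMk (measurable_pi_apply i))

/-- The distribution of the variables under the intervention `do(S = (x i)_{i ∈ S})`. -/
noncomputable def law (S : Finset V) (x : ∀ i, Ω i) : Measure (∀ i, Ω i) :=
  M.noise.map (M.solve S x)

/-- `F` consists of the interventional densities of the model: under `do(S = (x i)_{i ∈ S})`,
the variables in `S` are fixed and the others have the density `F S`. -/
structure Induces (μ : ∀ i, Measure (Ω i)) (F : Finset V → (∀ i, Ω i) → ℝ≥0∞) : Prop where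
  isInterventionalFamily : IsInterventionalFamily μ F
  law_apply : ∀ S, ∀ᵐ x ∂Measure.pi μ, ∀ A, MeasurableSet A →
    M.law S x A = lmarginal μ Sᶜ (A.indicator (F S)) x

/-- The standing properties of a causal model: it induces the interventional densities `F`, these
are consistent with its DAG, and the observational density `F ∅` is faithful to the DAG. -/
structure IsCausalModel (μ : ∀ i, Measure (Ω i)) (F : Finset V → (∀ i, Ω i) → ℝ≥0∞) :
    Prop where
  induces : M.Induces μ F
  compatible : M.D.IsCompatible μ F
  faithful : M.D.IsFaithful μ (F ∅)

end StructuralModel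

/-! Both halves reduce to separation in moral graphs of ancestral sets, which links densities and
adjustment sets to the DAG.

Shrinking an adjustment set. By faithfulness, an independence under the given density is a
d-separation. That is a property of the graph, so by the global Markov property the same
independence holds in every compatible family (`DAG.DSep.not_moralConn`,
`DAG.IsKernelFamily.condIndepDensity`). A computation with densities
(`AdjustmentFormula.of_condIndepDensity`) then carries the adjustment formula from `T` to `Z` in
every family. This shows that condition 5 makes `Z` an adjustment set. It also shows that a failure
of 1 or 2 at `t` makes `T \ {t}` one, so minimality implies 1 and 2.

Minimality from dependences. Every adjustment set separates `X` and `Y` in the moral graph formed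
after deleting the edges out of `X` (`IsAdjustmentSet.not_moralConn`). By the Markov property,
dependences 1 and 2 connect each `t` to `X` and to `Y` outside the rest of `T`. These connections
survive the deletion, by `T < X` in the first case and because `X` is conditioned on in the second.
Joining them at `t` shows that no proper subset of `T` separates (`MoralConn.of_ssubset`), so none
is an adjustment set.

The hard step is that adjustment forces separation. If it fails, there is a model in which the
treatment affects no other variable and yet the adjusted quantity varies with it. Unobserved nodes
emit independent biased bits and pass on what they receive, `Z` shows only exclusive ors of bits,
and `x` shows the bit of some `r₀`. A connection yields a bit, readable at `y`, whose sign is the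
sign of the bit of `r₀` times a function of `Z`. Adjusting for `Z` thus gives `y` a mean sign
proportional to the sign shown by `x`. The model has zero probabilities, so positive models are used
and a limit is taken. -/

set_option linter.unusedSectionVars false

/-! ### Moral connection -/

section Moral

variable {V : Type v}

/-- The nodes from which some element of `S` can be reached along `R`. -/
def ancestralSet (R : V → V → Prop) (S : Set V) : Set V :=
  {i | ∃ s ∈ S, Relation.ReflTransGen R i s}

/-- Adjacency in the moral graph of `R` on the nodes `W`, with the nodes in `C` removed. -/
def MoralAdj (R : V → V → Prop) (W C : Set V) (i j : V) : Prop :=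
  (i ∈ W ∧ i ∉ C) ∧ (j ∈ W ∧ j ∉ C) ∧ (R i j ∨ R j i ∨ ∃ s ∈ W, R i s ∧ R j s)

/-- Connection in the moral graph of `R` on the nodes `W`, with the nodes in `C` removed. -/
def MoralConn (R : V → V → Prop) (W C : Set V) : V → V → Prop :=
  Relation.ReflTransGen (MoralAdj R W C)

variable {R : V → V → Prop} {W C : Set V} {i j : V}

theorem MoralAdj.symm (h : MoralAdj R W C i j) : MoralAdj R W C j i := by
  obtain ⟨hi, hj, h⟩ := h
  refine ⟨hj, hi, ?_⟩
  rcases h with h | h | ⟨s, hs, h1, h2⟩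
  · exact Or.inr (Or.inl h)
  · exact Or.inl h
  · exact Or.inr (Or.inr ⟨s, hs, h2, h1⟩)

theorem MoralConn.symm (h : MoralConn R W C i j) : MoralConn R W C j i :=
  have : Std.Symm (MoralAdj R W C) := ⟨fun _ _ h => h.symm⟩
  (Relation.ReflTransGen.stdSymm (r := MoralAdj R W C)).symm _ _ h

theorem MoralConn.mono {R' : V → V → Prop} {W' C' : Set V}
    (h : ∀ i j, MoralAdj R W C i j → MoralAdj R' W' C' i j) (hc : MoralConn R W C i j) :
    MoralConn R' W' C' i j :=
  Relation.ReflTransGen.mono h _ _ hc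

theorem subset_ancestralSet (R : V → V → Prop) (S : Set V) : S ⊆ ancestralSet R S :=
  fun s hs => ⟨s, hs, .refl⟩

theorem ancestralSet_mono {S S' : Set V} (h : S ⊆ S') : ancestralSet R S ⊆ ancestralSet R S' :=
  fun _ ⟨s, hs, hr⟩ => ⟨s, h hs, hr⟩

theorem mem_ancestralSet_of_rel {S : Set V} (h : R i j) (hj : j ∈ ancestralSet R S) :
    i ∈ ancestralSet R S := by
  obtain ⟨s, hs, hr⟩ := hj
  exact ⟨s, hs, .head h hr⟩

end Moral

/-! ### Open walks -/

namespace DAG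

variable {V : Type v} (D : DAG V)

theorem not_adj_symm {i j : V} (h : D.Adj i j) : ¬ D.Adj j i :=
  fun h' => D.acyclic i (.tail (.single h) h')

/-- A walk: successive nodes are joined by an edge in either direction. -/
def IsWalk (p : List V) : Prop := p.IsChain (fun i j => D.Adj i j ∨ D.Adj j i)

variable {D} {C : Finset V}

/-- Prepending a node creates a single new triple, so only the former first node has to be checked.
-/
theorem IsOpen.cons {u w x : V} {l : List V} (h : D.IsOpen (u :: w :: l) C)
    (h1 : D.Adj u x ∨ D.Adj u w → u ∉ C)
    (h2 : D.Adj x u → D.Adj w u → ∃ c ∈ C, D.IsAncestor u c) :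
    D.IsOpen (x :: u :: w :: l) C := by
  constructor
  · rintro b ⟨a, c, hi, hb⟩
    rw [List.infix_cons_iff] at hi
    rcases hi with hi | hi
    · simp only [List.cons_prefix_cons] at hi
      obtain ⟨rfl, rfl, rfl, -⟩ := hi
      exact h1 hb
    · exact h.1 b ⟨a, c, hi, hb⟩
  · rintro b ⟨a, c, hi, hb, hb'⟩
    rw [List.infix_cons_iff] at hi
    rcases hi with hi | hi
    · simp only [List.cons_prefix_cons] at hi
      obtain ⟨rfl, rfl, rfl, -⟩ := hi
      exact h2 hb hb'
    · exact h.2 b ⟨a, c, hi, hb, hb'⟩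

theorem isOpen_of_length_le {p : List V} (hp : p.length ≤ 2) : D.IsOpen p C := by
  constructor
  · rintro b ⟨a, c, hi, -⟩
    have := hi.length_le
    simp at this
    omega
  · rintro b ⟨a, c, hi, -⟩
    have := hi.length_le
    simp at this
    omega

theorem IsOpen.of_infix {p q : List V} (h : D.IsOpen p C) (hq : q <:+: p) : D.IsOpen q C :=
  ⟨fun b ⟨a, c, hi, hb⟩ => h.1 b ⟨a, c, hi.trans hq, hb⟩,
    fun b ⟨a, c, hi, hb⟩ => h.2 b ⟨a, c, hi.trans hq, hb⟩⟩

theorem infix_append_cons_cases {a b c x : V} {l₁ l₂ : List V}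
    (h : [a, b, c] <:+: l₁ ++ x :: l₂) :
    [a, b, c] <:+: l₁ ++ [x] ∨ [a, b, c] <:+: x :: l₂ ∨
      (b = x ∧ (∃ l, l₁ = l ++ [a]) ∧ ∃ l, l₂ = c :: l) := by
  induction l₁ with
  | nil => exact Or.inr (Or.inl (by simpa using h))
  | cons y l ih =>
    rw [List.cons_append, List.infix_cons_iff] at h
    rcases h with h | h
    · match l, h with
      | [], h =>
        match l₂, h with
        | [], h => simp at h
        | d :: l₂, h =>
          simp only [List.nil_append, List.cons_prefix_cons] at h
          obtain ⟨rfl, rfl, rfl, -⟩ := h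
          exact Or.inr (Or.inr ⟨rfl, ⟨[], rfl⟩, ⟨l₂, rfl⟩⟩)
      | [z], h =>
        simp only [List.cons_append, List.nil_append, List.cons_prefix_cons] at h
        obtain ⟨rfl, rfl, rfl, -⟩ := h
        exact Or.inl (by simp)
      | z :: z' :: l, h =>
        simp only [List.cons_append, List.cons_prefix_cons] at h
        obtain ⟨rfl, rfl, rfl, -⟩ := h
        exact Or.inl ⟨[], l ++ [x], by simp⟩
    · rcases ih h with h | h | ⟨hb, ⟨l', rfl⟩, h'⟩
      · exact Or.inl (by rw [List.cons_append]; exact h.trans (List.suffix_cons _ _).isInfix)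
      · exact Or.inr (Or.inl h)
      · exact Or.inr (Or.inr ⟨hb, ⟨y :: l', rfl⟩, h'⟩)

/-- An open walk that starts along an edge out of `x` starts at an ancestor of `C` or of its
end. -/
theorem IsOpen.ancestor_or_transGen {l : List V} {x w y : V} (hw : D.IsWalk (x :: w :: l))
    (ho : D.IsOpen (x :: w :: l) C) (hx : D.Adj x w) (hy : (x :: w :: l).getLast? = some y) :
    (∃ c ∈ C, D.IsAncestor x c) ∨ Relation.TransGen D.Adj x y := by
  induction l generalizing x w with
  | nil =>
    simp at hy
    subst hy
    exact Or.inr (.single hx)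
  | cons d l ih =>
    have hw' : D.IsWalk (w :: d :: l) := hw.tail
    have hd : D.Adj w d ∨ D.Adj d w := by
      unfold IsWalk at hw'
      rw [List.isChain_cons_cons] at hw'
      exact hw'.1
    rcases hd with hd | hd
    · rcases ih hw' (ho.of_infix (List.suffix_cons _ _).isInfix) hd (by simpa using hy) with
        ⟨c, hc, h⟩ | h
      · exact Or.inl ⟨c, hc, .head hx h⟩
      · exact Or.inr (.head hx h)
    · obtain ⟨c, hc, h⟩ := ho.2 w ⟨x, d, ⟨[], l, by simp⟩, hx, hd⟩
      exact Or.inl ⟨c, hc, .head hx h⟩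

/-- Two visits of the same node on an open walk can be merged into one. -/
theorem IsOpen.cut {l₁ l₂ l₃ : List V} {x : V} (hw : D.IsWalk (l₁ ++ x :: l₂ ++ x :: l₃))
    (ho : D.IsOpen (l₁ ++ x :: l₂ ++ x :: l₃) C) : D.IsOpen (l₁ ++ x :: l₃) C := by
  have hleft : D.IsOpen (l₁ ++ [x]) C := ho.of_infix ⟨[], l₂ ++ x :: l₃, by simp⟩
  have hright : D.IsOpen (x :: l₃) C := ho.of_infix ⟨l₁ ++ x :: l₂, [], by simp⟩
  obtain ⟨d, m, hm⟩ : ∃ d m, l₂ ++ [x] = d :: m := by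
    cases l₂ with
    | nil => exact ⟨x, [], rfl⟩
    | cons d m => exact ⟨d, m ++ [x], rfl⟩
  obtain ⟨e, n, hn⟩ : ∃ e n, x :: l₂ = n ++ [e] := by
    rcases List.eq_nil_or_concat (x :: l₂) with h | ⟨n, e, h⟩
    · simp at h
    · exact ⟨e, n, by simpa using h⟩
  have hloop : x :: d :: m <:+: l₁ ++ x :: l₂ ++ x :: l₃ :=
    ⟨l₁, l₃, by rw [← hm]; simp⟩
  have hwl : D.IsWalk (x :: d :: m) := List.IsChain.infix hw hloop
  have hol := ho.of_infix hloop
  have hlast : (x :: d :: m).getLast? = some x := by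
    rw [← hm, ← List.cons_append, List.getLast?_concat]
  have hfirst : ∀ a, (∃ l, l₁ = l ++ [a]) →
      [a, x, d] <:+: l₁ ++ x :: l₂ ++ x :: l₃ := by
    rintro a ⟨l, rfl⟩
    refine ⟨l, m ++ l₃, ?_⟩
    have : l₂ ++ x :: l₃ = d :: m ++ l₃ := by rw [← hm]; simp
    simp [this]
  have hsecond : ∀ c, (∃ l, l₃ = c :: l) →
      [e, x, c] <:+: l₁ ++ x :: l₂ ++ x :: l₃ := by
    rintro c ⟨l, rfl⟩
    refine ⟨l₁ ++ n, l, ?_⟩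
    rw [List.append_assoc l₁ (x :: l₂), hn]
    simp
  constructor
  · rintro b ⟨a, c, hi, hb⟩
    rcases infix_append_cons_cases hi with hi | hi | ⟨rfl, ha, hc⟩
    · exact hleft.1 b ⟨a, c, hi, hb⟩
    · exact hright.1 b ⟨a, c, hi, hb⟩
    -- The edge out of `b` already occurs in the triple around the first visit or in the one around
    -- the second.
    · rcases hb with hb | hb
      · exact ho.1 b ⟨a, d, hfirst a ha, Or.inl hb⟩
      · exact ho.1 b ⟨e, c, hsecond c hc, Or.inr hb⟩
  · rintro b ⟨a, c, hi, hb, hb'⟩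
    rcases infix_append_cons_cases hi with hi | hi | ⟨rfl, ha, hc⟩
    · exact hleft.2 b ⟨a, c, hi, hb, hb'⟩
    · exact hright.2 b ⟨a, c, hi, hb, hb'⟩
    · have hd : D.Adj b d ∨ D.Adj d b := by
        unfold IsWalk at hwl
        rw [List.isChain_cons_cons] at hwl
        exact hwl.1
      rcases hd with hd | hd
      -- The loop leaves `b` along an outgoing edge and returns to `b`. Unless it meets a collider,
      -- which makes `b` an ancestor of `C`, it is a directed cycle.
      · rcases hol.ancestor_or_transGen hwl hd hlast with h | h
        · exact h
        · exact absurd h (D.acyclic b)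
      · exact ho.2 b ⟨a, d, hfirst a ha, hb, hd⟩

theorem exists_eq_append_of_not_nodup {p : List V} (h : ¬ p.Nodup) :
    ∃ l₁ x l₂ l₃, p = l₁ ++ x :: l₂ ++ x :: l₃ := by
  induction p with
  | nil => simp at h
  | cons a l ih =>
    by_cases ha : a ∈ l
    · obtain ⟨s, t, rfl⟩ := List.append_of_mem ha
      exact ⟨[], a, s, t, by simp⟩
    · obtain ⟨l₁, x, l₂, l₃, rfl⟩ := ih (fun hl => h (List.nodup_cons.2 ⟨ha, hl⟩))
      exact ⟨a :: l₁, x, l₂, l₃, by simp⟩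

/-- An open walk can be shortened to an open path with the same ends. -/
theorem IsOpen.exists_isPath {p : List V} (hp : p ≠ []) (hw : D.IsWalk p) (ho : D.IsOpen p C) :
    ∃ q, D.IsPath q ∧ D.IsOpen q C ∧ q.head? = p.head? ∧ q.getLast? = p.getLast? := by
  induction hn : p.length using Nat.strong_induction_on generalizing p with
  | _ n ih =>
    by_cases hd : p.Nodup
    · exact ⟨p, ⟨hp, hd, hw⟩, ho, rfl, rfl⟩
    · obtain ⟨l₁, x, l₂, l₃, rfl⟩ := exists_eq_append_of_not_nodup hd
      have hw' : D.IsWalk (l₁ ++ x :: l₃) := by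
        have hleft : (l₁ ++ [x]).IsChain (fun i j => D.Adj i j ∨ D.Adj j i) :=
          List.IsChain.infix hw ⟨[], l₂ ++ x :: l₃, by simp⟩
        have hright : (x :: l₃).IsChain (fun i j => D.Adj i j ∨ D.Adj j i) :=
          List.IsChain.infix hw ⟨l₁ ++ x :: l₂, [], by simp⟩
        exact List.isChain_split.2 ⟨hleft, hright⟩
      obtain ⟨q, hq, hqo, hh, hl⟩ := ih (l₁ ++ x :: l₃).length (by simp at hn ⊢; omega)
        (by simp) hw' (ho.cut hw) rfl
      refine ⟨q, hq, hqo, hh.trans ?_, hl.trans ?_⟩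
      · cases l₁ <;> simp
      · rw [List.getLast?_append, List.getLast?_append, List.getLast?_cons]
        rfl

/-! ### From moral connections to open walks -/

/-- There is an open walk from `x` to `B` given `C`, that can be continued beyond `x` in any
direction if `x ∉ C`, and by an edge into `x` in all cases. -/
def OpenReach (D : DAG V) (B C : Finset V) (x : V) : Prop :=
  ∃ l, D.IsWalk (x :: l) ∧ D.IsOpen (x :: l) C ∧ (∃ b ∈ B, (x :: l).getLast? = some b) ∧
    (l = [] ∨ ∃ w l', l = w :: l' ∧
      (D.Adj x w ∧ x ∉ C ∨ D.Adj w x ∧ ∃ c ∈ C, D.IsAncestor x c))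

variable {B : Finset V}

/-- The directed path itself is open: it has no colliders, and none of its nodes is in `C`, since
`x` is no ancestor of `C`. -/
theorem openReach_of_isAncestor {x b : V} (hb : b ∈ B) (h : D.IsAncestor x b)
    (hx : ¬ ∃ c ∈ C, D.IsAncestor x c) : OpenReach D B C x := by
  induction h using Relation.ReflTransGen.head_induction_on with
  | refl => exact ⟨[], by simp [IsWalk], isOpen_of_length_le (by simp), ⟨b, hb, rfl⟩, Or.inl rfl⟩
  | @head x y hxy _ ih =>
    have hy : ¬ ∃ c ∈ C, D.IsAncestor y c := fun ⟨c, hc, h⟩ => hx ⟨c, hc, .head hxy h⟩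
    have hxC : x ∉ C := fun hc => hx ⟨x, hc, .refl⟩
    have hyC : y ∉ C := fun hc => hy ⟨y, hc, .refl⟩
    obtain ⟨l, hw, ho, ⟨b', hb', hl⟩, hd⟩ := ih hy
    refine ⟨y :: l, ?_, ?_, ⟨b', hb', by simpa using hl⟩, Or.inr ⟨y, l, rfl, Or.inl ⟨hxy, hxC⟩⟩⟩
    · exact List.isChain_cons_cons.2 ⟨Or.inl hxy, hw⟩
    · rcases hd with rfl | ⟨w, l', rfl, ⟨hyw, -⟩ | ⟨-, h⟩⟩
      · exact isOpen_of_length_le (by simp)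
      · exact ho.cons (fun _ => hyC) (fun _ h => absurd h (D.not_adj_symm hyw))
      · exact absurd h hy

theorem exists_openWalk_of_isAncestor {x w a : V} {l : List V} (hw : D.IsWalk (x :: w :: l))
    (ho : D.IsOpen (x :: w :: l) C) (h : D.IsAncestor x a) (hx : ¬ ∃ c ∈ C, D.IsAncestor x c) :
    ∃ l', D.IsWalk (a :: l') ∧ D.IsOpen (a :: l') C ∧
      (a :: l').getLast? = (x :: w :: l).getLast? := by
  induction h using Relation.ReflTransGen.head_induction_on generalizing w l with
  | refl => exact ⟨_, hw, ho, rfl⟩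
  | @head x y hxy _ ih =>
    have hy : ¬ ∃ c ∈ C, D.IsAncestor y c := fun ⟨c, hc, h⟩ => hx ⟨c, hc, .head hxy h⟩
    have hxC : x ∉ C := fun hc => hx ⟨x, hc, .refl⟩
    obtain ⟨l', h1, h2, h3⟩ := ih (w := x) (l := w :: l)
      (List.isChain_cons_cons.2 ⟨Or.inr hxy, hw⟩)
      (ho.cons (fun _ => hxC) (fun h => absurd h (D.not_adj_symm hxy))) hy
    exact ⟨l', h1, h2, by simpa using h3⟩

theorem OpenReach.out {x y : V} (h : OpenReach D B C x) (hxy : D.Adj y x) (hy : y ∉ C) :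
    OpenReach D B C y := by
  obtain ⟨l, hw, ho, ⟨b, hb, hl⟩, hd⟩ := h
  refine ⟨x :: l, List.isChain_cons_cons.2 ⟨Or.inl hxy, hw⟩, ?_, ⟨b, hb, by simpa using hl⟩,
    Or.inr ⟨x, l, rfl, Or.inl ⟨hxy, hy⟩⟩⟩
  rcases hd with rfl | ⟨w, l', rfl, ⟨hxw, hx⟩ | ⟨hwx, hx⟩⟩
  · exact isOpen_of_length_le (by simp)
  · exact ho.cons (fun _ => hx) (fun _ h => absurd h (D.not_adj_symm hxw))
  · exact ho.cons (fun h => h.elim (fun h => absurd h (D.not_adj_symm hxy))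
      (fun h => absurd h (D.not_adj_symm hwx))) (fun _ _ => hx)

/-- If `y` is an ancestor of `C`, it may serve as a collider. Otherwise a directed path descends
from `y`, avoiding `C`, to `A` or `B`: in the first case it completes an open walk between `A` and
`B`, in the second it is a fresh open walk to `B`. -/
theorem OpenReach.into {A : Finset V} {x y : V} (h : OpenReach D B C x) (hxy : D.Adj x y)
    (hx : x ∉ C) (hy : y ∈ ancestralSet D.Adj (A ∪ B ∪ C : Set V)) :
    (∃ a ∈ A, ∃ l, D.IsWalk (a :: l) ∧ D.IsOpen (a :: l) C ∧
      ∃ b ∈ B, (a :: l).getLast? = some b) ∨ OpenReach D B C y := by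
  obtain ⟨l, hw, ho, ⟨b, hb, hl⟩, hd⟩ := h
  have hw' : D.IsWalk (y :: x :: l) := List.isChain_cons_cons.2 ⟨Or.inr hxy, hw⟩
  have ho' : D.IsOpen (y :: x :: l) C := by
    rcases hd with rfl | ⟨w, l', rfl, -⟩
    · exact isOpen_of_length_le (by simp)
    · exact ho.cons (fun _ => hx) (fun h => absurd h (D.not_adj_symm hxy))
  by_cases hyC : ∃ c ∈ C, D.IsAncestor y c
  · exact Or.inr ⟨x :: l, hw', ho', ⟨b, hb, by simpa using hl⟩,
      Or.inr ⟨x, l, rfl, Or.inr ⟨hxy, hyC⟩⟩⟩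
  · obtain ⟨s, (hs | hs) | hs, hys⟩ := hy
    · obtain ⟨l', h1, h2, h3⟩ := exists_openWalk_of_isAncestor hw' ho' hys hyC
      exact Or.inl ⟨s, hs, l', h1, h2, b, hb, by rw [h3]; simpa using hl⟩
    · exact Or.inr (openReach_of_isAncestor hs hys hyC)
    · exact absurd ⟨s, hs, hys⟩ hyC

/-- d-separation implies separation in the moral graph of the ancestral set. -/
theorem DSep.not_moralConn {A : Finset V} (h : D.DSep A B C) {a b : V} (ha : a ∈ A)
    (hb : b ∈ B) :
    ¬ MoralConn D.Adj (ancestralSet D.Adj (A ∪ B ∪ C : Set V)) C b a := by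
  intro hc
  have key : (∃ a ∈ A, ∃ l, D.IsWalk (a :: l) ∧ D.IsOpen (a :: l) C ∧
      ∃ b ∈ B, (a :: l).getLast? = some b) ∨ OpenReach D B C a := by
    clear ha
    induction hc with
    | refl =>
      exact Or.inr
        ⟨[], by simp [IsWalk], isOpen_of_length_le (by simp), ⟨b, hb, rfl⟩, Or.inl rfl⟩
    | @tail x y _ hxy ih =>
      rcases ih with ih | ih
      · exact Or.inl ih
      obtain ⟨⟨-, hxC⟩, ⟨hyW, hyC⟩, hxy | hxy | ⟨s, hs, hxs, hys⟩⟩ := hxy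
      · exact ih.into hxy hxC hyW
      · exact Or.inr (ih.out hxy hyC)
      -- A marriage is replaced by the two edges through the common child.
      · rcases ih.into hxs hxC hs with h | h
        · exact Or.inl h
        · exact Or.inr (h.out hys hyC)
  obtain ⟨a, ha, l, hw, ho, b, hb, hl⟩ : ∃ a ∈ A, ∃ l, D.IsWalk (a :: l) ∧
      D.IsOpen (a :: l) C ∧ ∃ b ∈ B, (a :: l).getLast? = some b := by
    rcases key with key | ⟨l, hw, ho, hl, -⟩
    · exact key
    · exact ⟨a, ha, l, hw, ho, hl⟩
  obtain ⟨q, hq, hqo, hh, hl'⟩ := ho.exists_isPath (by simp) hw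
  exact h q ⟨hq, ⟨a, ha, by simpa using hh⟩, ⟨b, hb, hl'.trans hl⟩⟩ hqo

end DAG

/-! ### Minimal separators of the moral graph -/

section Separators

variable {V : Type v} {R : V → V → Prop}

/-- Stop the walk at its first visit to `t`: the nodes before it avoid all of `T`. -/
theorem MoralConn.exists_last {W T : Set V} {x t : V} (hx : x ∉ T) (ht : t ∈ T)
    (h : MoralConn R W (T \ {t}) x t) :
    ∃ i, MoralConn R W T x i ∧ MoralAdj R W (T \ {t}) i t := by
  have key : ∀ y, MoralConn R W (T \ {t}) x y → (MoralConn R W T x y ∧ y ∉ T) ∨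
      ∃ i, MoralConn R W T x i ∧ MoralAdj R W (T \ {t}) i t := by
    intro y hy
    induction hy with
    | refl => exact Or.inl ⟨.refl, hx⟩
    | @tail y z _ hyz ih =>
      rcases ih with ⟨ih, hyT⟩ | ih
      · by_cases hz : z = t
        · subst hz
          exact Or.inr ⟨y, ih, hyz⟩
        · have hzT : z ∉ T := fun h => hyz.2.1.2 ⟨h, hz⟩
          exact Or.inl ⟨.tail ih ⟨⟨hyz.1.1, hyT⟩, ⟨hyz.2.1.1, hzT⟩, hyz.2.2⟩, hzT⟩
      · exact Or.inr ih
  rcases key t h with h | h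
  · exact absurd ht h.2
  · exact h

/-- If every element of a separator `T` is connected to both `x` and `y` outside the rest of `T`,
then no proper subset of `T` is a separator. -/
theorem MoralConn.of_ssubset [Finite V] (hR : ∀ i, ¬ Relation.TransGen R i i) {x y : V}
    {T Z : Set V} (hx : x ∉ T) (hy : y ∉ T) (hZ : Z ⊂ T)
    (hxT : ∀ t ∈ T, MoralConn R (ancestralSet R ({x, y} ∪ T)) (T \ {t}) x t)
    (hyT : ∀ t ∈ T, MoralConn R (ancestralSet R ({x, y} ∪ T)) (T \ {t}) y t)
    (hsep : ¬ MoralConn R (ancestralSet R ({x, y} ∪ T)) T x y) :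
    MoralConn R (ancestralSet R ({x, y} ∪ Z)) Z x y := by
  -- In this case passing to `Z` loses no node, and any `t` in `T` outside `Z` joins its connections
  -- to `x` and to `y`.
  by_cases hTW : T ⊆ ancestralSet R ({x, y} ∪ Z)
  · have hW : ancestralSet R ({x, y} ∪ T) ⊆ ancestralSet R ({x, y} ∪ Z) := by
      rintro i ⟨s, hs | hs, his⟩
      · exact ⟨s, Or.inl hs, his⟩
      · obtain ⟨s', hs', hss'⟩ := hTW hs
        exact ⟨s', hs', his.trans hss'⟩
    obtain ⟨t, ht, htZ⟩ := Set.exists_of_ssubset hZ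
    have hC : Z ⊆ T \ {t} := fun z hz => ⟨hZ.1 hz, fun h => htZ (h ▸ hz)⟩
    have hmono : ∀ i j, MoralAdj R (ancestralSet R ({x, y} ∪ T)) (T \ {t}) i j →
        MoralAdj R (ancestralSet R ({x, y} ∪ Z)) Z i j := by
      rintro i j ⟨hi, hj, h⟩
      refine ⟨⟨hW hi.1, fun h => hi.2 (hC h)⟩, ⟨hW hj.1, fun h => hj.2 (hC h)⟩, ?_⟩
      rcases h with h | h | ⟨s, hs, h⟩
      · exact Or.inl h
      · exact Or.inr (Or.inl h)
      · exact Or.inr (Or.inr ⟨s, hW hs, h⟩)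
    exact ((hxT t ht).mono hmono).trans ((hyT t ht).mono hmono).symm
  · exfalso
    have hwf : WellFounded (Function.swap (Relation.TransGen R)) := by
      have : Std.Irrefl (Function.swap (Relation.TransGen R)) := ⟨hR⟩
      have : IsTrans V (Function.swap (Relation.TransGen R)) := ⟨fun _ _ _ h h' => h'.trans h⟩
      exact Finite.wellFounded_of_trans_of_irrefl _
    -- A most downstream such `t` is a sink of the larger ancestral set. The connections from `x`
    -- and `y` therefore both enter `t` along edges, and `t` marries their last nodes: this bypasses
    -- `T`.
    obtain ⟨t, ⟨htT, htW⟩, hmax⟩ := hwf.has_min (T \ ancestralSet R ({x, y} ∪ Z)) (by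
      obtain ⟨t, h1, h2⟩ := Set.not_subset.1 hTW
      exact ⟨t, h1, h2⟩)
    have hsink : ∀ s ∈ ancestralSet R ({x, y} ∪ T), ¬ R t s := by
      rintro s ⟨s', hs', hss'⟩ hts
      have hts' : Relation.TransGen R t s' := Relation.TransGen.head' hts hss'
      by_cases h : s' ∈ ancestralSet R ({x, y} ∪ Z)
      · obtain ⟨r, hr, hs'r⟩ := h
        exact htW ⟨r, hr, hts'.to_reflTransGen.trans hs'r⟩
      · rcases hs' with hs' | hs'
        · exact h ⟨s', Or.inl hs', .refl⟩
        · exact hmax s' ⟨hs', h⟩ hts'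
    have hlast : ∀ i, MoralAdj R (ancestralSet R ({x, y} ∪ T)) (T \ {t}) i t → R i t := by
      rintro i ⟨hi, -, h | h | ⟨s, hs, -, h⟩⟩
      · exact h
      · exact absurd h (hsink i hi.1)
      · exact absurd h (hsink s hs)
    obtain ⟨i, hxi, hit⟩ := (hxT t htT).exists_last hx htT
    obtain ⟨j, hyj, hjt⟩ := (hyT t htT).exists_last hy htT
    have hiT : i ∉ T := fun h =>
      hit.1.2 ⟨h, fun h' => hR t (.single (by have := hlast i hit; rwa [h'] at this))⟩
    have hjT : j ∉ T := fun h =>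
      hjt.1.2 ⟨h, fun h' => hR t (.single (by have := hlast j hjt; rwa [h'] at this))⟩
    refine hsep (Relation.ReflTransGen.trans (.tail hxi ?_) hyj.symm)
    exact ⟨⟨hit.1.1, hiT⟩, ⟨hjt.1.1, hjT⟩, Or.inr (Or.inr ⟨t, hit.2.1.1, hlast i hit, hlast j hjt⟩)⟩

end Separators

/-! ### The graph without the edges out of the treatment -/

namespace DAG

variable {V : Type v} (D : DAG V)

/-- The edges of `D` that do not start at `x`. -/
def BackdoorAdj (x i j : V) : Prop := D.Adj i j ∧ i ≠ x

variable {D}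

theorem BackdoorAdj.acyclic (x i : V) : ¬ Relation.TransGen (D.BackdoorAdj x) i i :=
  fun h => D.acyclic i (Relation.TransGen.mono (fun _ _ h => h.1) _ _ h)

/-- A directed path through `x` may be stopped there, as `x` is in the target set. -/
theorem ancestralSet_backdoorAdj {x : V} {S : Set V} (hx : x ∈ S) :
    ancestralSet (D.BackdoorAdj x) S = ancestralSet D.Adj S := by
  ext i
  constructor
  · rintro ⟨s, hs, h⟩
    exact ⟨s, hs, Relation.ReflTransGen.mono (fun _ _ h => h.1) _ _ h⟩
  · rintro ⟨s, hs, h⟩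
    induction h using Relation.ReflTransGen.head_induction_on with
    | refl => exact ⟨s, hs, .refl⟩
    | @head i j hij _ ih =>
      by_cases hi : i = x
      · exact ⟨x, hx, hi ▸ .refl⟩
      · exact mem_ancestralSet_of_rel ⟨hij, hi⟩ ih

theorem MoralConn.backdoorAdj_of_mem {x i j : V} {S C : Set V} (hx : x ∈ S) (hxC : x ∈ C)
    (h : MoralConn D.Adj (ancestralSet D.Adj S) C i j) :
    MoralConn (D.BackdoorAdj x) (ancestralSet (D.BackdoorAdj x) S) C i j := by
  refine h.mono ?_
  rintro i j ⟨hi, hj, h⟩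
  have hix : i ≠ x := fun h => hi.2 (h ▸ hxC)
  have hjx : j ≠ x := fun h => hj.2 (h ▸ hxC)
  rw [ancestralSet_backdoorAdj hx]
  refine ⟨hi, hj, ?_⟩
  rcases h with h | h | ⟨s, hs, h1, h2⟩
  · exact Or.inl ⟨h, hix⟩
  · exact Or.inr (Or.inl ⟨h, hjx⟩)
  · exact Or.inr (Or.inr ⟨s, hs, ⟨h1, hix⟩, ⟨h2, hjx⟩⟩)

/-- An edge out of `x` into the ancestral set would make `x` an ancestor of `T` or close a cycle, so
nothing is deleted there. -/
theorem MoralConn.backdoorAdj_of_not_isAncestor {x i j : V} {T C : Set V}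
    (hT : ∀ t ∈ T, ¬ D.IsAncestor x t)
    (h : MoralConn D.Adj (ancestralSet D.Adj ({x} ∪ T)) C i j) :
    MoralConn (D.BackdoorAdj x) (ancestralSet (D.BackdoorAdj x) ({x} ∪ T)) C i j := by
  have hout : ∀ s ∈ ancestralSet D.Adj ({x} ∪ T), ∀ i, D.Adj i s → i ≠ x := by
    rintro s ⟨t, rfl | ht, hst⟩ i his rfl
    · exact D.acyclic i (Relation.TransGen.head' his hst)
    · exact hT t ht (.head his hst)
  refine h.mono ?_
  rintro i j ⟨hi, hj, h⟩
  rw [ancestralSet_backdoorAdj (Set.mem_union_left T (Set.mem_singleton x))]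
  refine ⟨hi, hj, ?_⟩
  rcases h with h | h | ⟨s, hs, h1, h2⟩
  · exact Or.inl ⟨h, hout j hj.1 i h⟩
  · exact Or.inr (Or.inl ⟨h, hout i hi.1 j h⟩)
  · exact Or.inr (Or.inr ⟨s, hs, ⟨h1, hout s hs i h1⟩, ⟨h2, hout s hs j h2⟩⟩)

/-! ### Signals through unobserved nodes -/

variable (D)

/-- There is a directed path from `r` to `i` with no node after `r` in `N`. -/
def Carries (N : Set V) (r i : V) : Prop :=
  Relation.ReflTransGen (fun i j => D.Adj i j ∧ j ∉ N) r i

/-- Some parent of `s` carries the signal of `r`. -/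
def Visible (N : Set V) (s r : V) : Prop := ∃ p, D.Adj p s ∧ D.Carries N r p

/-- The signals of `r` and `r'`, unobserved nodes, are both visible to an element of `Z`. -/
def Linked (N Z : Set V) (r r' : V) : Prop :=
  r ∉ N ∧ r' ∉ N ∧ ∃ z ∈ Z, D.Visible N z r ∧ D.Visible N z r'

/-- The node `i` is linked to a node whose signal is visible to `x`. -/
def LinkedTo (N Z : Set V) (x i : V) : Prop :=
  ∃ r, r ∉ N ∧ D.Visible N x r ∧ Relation.ReflTransGen (D.Linked N Z) r i

variable {D} {N Z : Set V} {x y i j : V}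

theorem Visible.head (h : D.Visible N x j) (hij : D.Adj i j) (hj : j ∉ N) : D.Visible N x i := by
  obtain ⟨p, hp, hjp⟩ := h
  exact ⟨p, hp, .head ⟨hij, hj⟩ hjp⟩

theorem LinkedTo.notMem (h : D.LinkedTo N Z x i) : i ∉ N := by
  obtain ⟨r, hr, -, h⟩ := h
  induction h with
  | refl => exact hr
  | tail _ h _ => exact h.2.1

/-- The signal of `i` passes through `j`, so it is visible wherever that of `j` is, and `i` can
replace `j` at the end of the chain. -/
theorem LinkedTo.of_adj (h : D.LinkedTo N Z x j) (hij : D.Adj i j) (hi : i ∉ N) :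
    D.LinkedTo N Z x i := by
  have hj := h.notMem
  obtain ⟨r, hr, hv, h⟩ := h
  cases h with
  | refl => exact ⟨i, hi, hv.head hij hj, .refl⟩
  | tail h h' =>
    obtain ⟨h1, -, z, hz, h3, h4⟩ := h'
    exact ⟨r, hr, hv, .tail h ⟨h1, hi, z, hz, h3, h4.head hij hj⟩⟩

/-- Follow a directed path to its first node in `insert x Z`; if it meets none, it ends at `y`. -/
theorem carries_or_visible (hi : i ∉ insert x Z)
    (h : i ∈ ancestralSet (D.BackdoorAdj x) ({x, y} ∪ Z)) :
    D.Carries (insert x Z) i y ∨ ∃ s ∈ insert x Z, D.Visible (insert x Z) s i := by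
  obtain ⟨s, hs, h⟩ := h
  induction h using Relation.ReflTransGen.head_induction_on with
  | refl =>
    rcases hs with (rfl | rfl) | hs
    · exact absurd (Set.mem_insert _ _) hi
    · exact Or.inl .refl
    · exact absurd (Set.mem_insert_of_mem _ hs) hi
  | @head i j hij _ ih =>
    by_cases hj : j ∈ insert x Z
    · exact Or.inr ⟨j, hj, i, hij.1, .refl⟩
    · rcases ih hj with h | ⟨s, hs, h⟩
      · exact Or.inl (.head ⟨hij.1, hj⟩ h)
      · exact Or.inr ⟨s, hs, h.head hij.1 hj⟩

/-- The signal of `j` reaches `y`, `x` or `Z`. In the first case that of `i` goes along, in the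
second `j` starts a new chain, and in the third `i` and `j` are visible to the same element of `Z`.
-/
theorem LinkedTo.carries_or_linkedTo (h : D.LinkedTo (insert x Z) Z x i) (hij : D.Adj i j)
    (hj : j ∉ insert x Z) (hjW : j ∈ ancestralSet (D.BackdoorAdj x) ({x, y} ∪ Z)) :
    D.Carries (insert x Z) i y ∨ D.LinkedTo (insert x Z) Z x j := by
  rcases carries_or_visible hj hjW with h' | ⟨s, rfl | hs, h'⟩
  · exact Or.inl (.head ⟨hij, hj⟩ h')
  · exact Or.inr ⟨j, hj, h', .refl⟩
  · have hi := h.notMem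
    obtain ⟨r, hr, hv, h⟩ := h
    exact Or.inr ⟨r, hr, hv, .tail h ⟨hi, hj, s, hs, h'.head hij hj, h'⟩⟩

/-- If `x` and `y` are connected in the moral graph without the edges out of `x` and without `Z`,
then `y` carries a signal that is linked to one visible to `x`. -/
theorem exists_linkedTo_carries (hxy : x ≠ y)
    (h : MoralConn (D.BackdoorAdj x) (ancestralSet (D.BackdoorAdj x) ({x, y} ∪ Z)) Z x y) :
    ∃ i, D.LinkedTo (insert x Z) Z x i ∧ D.Carries (insert x Z) i y := by
  have key : ∀ j, MoralConn (D.BackdoorAdj x) (ancestralSet (D.BackdoorAdj x) ({x, y} ∪ Z)) Z x j →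
      (∃ i, D.LinkedTo (insert x Z) Z x i ∧ D.Carries (insert x Z) i y) ∨ j = x ∨
        D.LinkedTo (insert x Z) Z x j := by
    intro j hj
    induction hj with
    | refl => exact Or.inr (Or.inl rfl)
    | @tail i j _ hij ih =>
      by_cases hjx : j = x
      · exact Or.inr (Or.inl hjx)
      obtain ⟨hi, hj, hij⟩ := hij
      have hjN : j ∉ insert x Z := by
        rintro (h | h)
        exacts [hjx h, hj.2 h]
      rcases ih with ih | rfl | ih
      · exact Or.inl ih
      -- No edge leaves `x`, so the next node is a parent of `x`.
      · rcases hij with h | h | ⟨s, -, h, -⟩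
        · exact absurd rfl h.2
        · exact Or.inr (Or.inr ⟨j, hjN, ⟨j, h.1, .refl⟩, .refl⟩)
        · exact absurd rfl h.2
      · rcases hij with h | h | ⟨s, hs, h1, h2⟩
        · rcases ih.carries_or_linkedTo h.1 hjN hj.1 with h' | h'
          · exact Or.inl ⟨i, ih, h'⟩
          · exact Or.inr (Or.inr h')
        · exact Or.inr (Or.inr (ih.of_adj h.1 hjN))
        · by_cases hsx : s = x
          · subst hsx
            exact Or.inr (Or.inr ⟨j, hjN, ⟨j, h2.1, .refl⟩, .refl⟩)
          by_cases hsZ : s ∈ Z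
          · have hiN := ih.notMem
            obtain ⟨r, hr, hv, h⟩ := ih
            exact Or.inr (Or.inr ⟨r, hr, hv, .tail h
              ⟨hiN, hjN, s, hsZ, ⟨i, h1.1, .refl⟩, ⟨j, h2.1, .refl⟩⟩⟩)
          · have hsN : s ∉ insert x Z := by
              rintro (h | h)
              exacts [hsx h, hsZ h]
            rcases ih.carries_or_linkedTo h1.1 hsN hs with h' | h'
            · exact Or.inl ⟨i, ih, h'⟩
            · exact Or.inr (Or.inr (h'.of_adj h2.1 hjN))
  rcases key y h with h | h | h
  · exact h
  · exact absurd h.symm hxy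
  · exact ⟨y, h, .refl⟩

end DAG

/-! ### Partial integrals -/

section Marginals

variable {V : Type v} [Fintype V] [DecidableEq V] {Ω : V → Type u}
  [∀ i, MeasurableSpace (Ω i)] {μ : ∀ i, Measure (Ω i)} [∀ i, SigmaFinite (μ i)]

theorem updateFinset_apply_of_notMem {s : Finset V} (w : ∀ i, Ω i) (y : ∀ i : s, Ω i) {i : V}
    (hi : i ∉ s) : Function.updateFinset w s y i = w i := by
  simp [Function.updateFinset, hi]

theorem lmarginal_mul_left {s : Finset V} {A : Set V} {g f : (∀ i, Ω i) → ℝ≥0∞}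
    (hf : Measurable f) (hg : DependsOn g A) (hA : ∀ i ∈ s, i ∉ A) (w : ∀ i, Ω i) :
    lmarginal μ s (fun w => g w * f w) w = g w * lmarginal μ s f w := by
  unfold lmarginal
  have hm : Measurable fun y => f (Function.updateFinset w s y) := hf.comp measurable_updateFinset
  rw [← lintegral_const_mul _ hm]
  refine lintegral_congr fun y => ?_
  refine congrArg (· * _) (hg fun i hi => updateFinset_apply_of_notMem w y fun his => hA i his hi)

theorem lmarginal_eq_lmarginal_sdiff {s t : Finset V} (hst : s ⊆ t) {f : (∀ i, Ω i) → ℝ≥0∞}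
    (hf : Measurable f) : lmarginal μ t f = lmarginal μ s (lmarginal μ (t \ s) f) := by
  rw [← lmarginal_union μ f hf Finset.disjoint_sdiff, Finset.union_sdiff_of_subset hst]

theorem dependsOn_lmarginal {s : Finset V} {A : Set V} {f : (∀ i, Ω i) → ℝ≥0∞}
    (hf : DependsOn f A) : DependsOn (lmarginal μ s f) (A \ s) := by
  intro w w' h
  unfold lmarginal
  refine lintegral_congr fun y => hf fun i hi => ?_
  by_cases his : i ∈ s
  · simp [Function.updateFinset, his]
  · rw [updateFinset_apply_of_notMem w y his, updateFinset_apply_of_notMem w' y his]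
    exact h i ⟨hi, his⟩

theorem dependsOn_marginalDensity (f : (∀ i, Ω i) → ℝ≥0∞) (S : Finset V) :
    DependsOn (marginalDensity μ f S) S := by
  intro w w' h
  exact lmarginal_congr μ f fun i hi => h i (by simpa using hi)

theorem measurable_marginalDensity {f : (∀ i, Ω i) → ℝ≥0∞} (hf : Measurable f) (S : Finset V) :
    Measurable (marginalDensity μ f S) :=
  hf.lmarginal μ

theorem lmarginal_marginalDensity {f : (∀ i, Ω i) → ℝ≥0∞} (hf : Measurable f) {S S' : Finset V}
    (h : S ⊆ S') : lmarginal μ (S' \ S) (marginalDensity μ f S') = marginalDensity μ f S := by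
  unfold marginalDensity
  rw [← lmarginal_union μ f hf]
  · congr 1
    ext i
    simp only [Finset.mem_union, Finset.mem_sdiff, Finset.mem_compl]
    have := @h i
    tauto
  · rw [Finset.disjoint_left]
    simp +contextual

theorem lmarginal_lmarginal_compl {f : (∀ i, Ω i) → ℝ≥0∞} (hf : Measurable f) (s : Finset V)
    (w : ∀ i, Ω i) : lmarginal μ s (lmarginal μ sᶜ f) w = ∫⁻ w, f w ∂Measure.pi μ := by
  rw [← lmarginal_union μ f hf disjoint_compl_right, Finset.union_compl, lmarginal_univ]

/-- Tonelli: a measurable set whose slices along `s` are all null is null. -/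
theorem ae_of_forall_ae_updateFinset (s : Finset V) {P : (∀ i, Ω i) → Prop}
    (hP : MeasurableSet {w | P w})
    (h : ∀ w, ∀ᵐ y ∂Measure.pi (fun i : s => μ i), P (Function.updateFinset w s y)) :
    ∀ᵐ w ∂Measure.pi μ, P w := by
  have hm : Measurable ({w | P w}ᶜ.indicator (1 : (∀ i, Ω i) → ℝ≥0∞)) :=
    measurable_one.indicator hP.compl
  have h0 : lmarginal μ s ({w | P w}ᶜ.indicator (1 : (∀ i, Ω i) → ℝ≥0∞)) = 0 := by
    funext w
    refine (lintegral_congr_ae ?_).trans lintegral_zero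
    filter_upwards [h w] with y hy
    simp [hy]
  have h1 : ∫⁻ w, {w | P w}ᶜ.indicator (1 : (∀ i, Ω i) → ℝ≥0∞) w ∂Measure.pi μ = 0 := by
    rcases isEmpty_or_nonempty (∀ i, Ω i) with _ | ⟨⟨w⟩⟩
    · exact lintegral_of_isEmpty _ _
    · rw [← lmarginal_lmarginal_compl hm sᶜ w, compl_compl, h0]
      exact lintegral_zero
  rw [lintegral_indicator_one hP.compl] at h1
  exact h1

/-- The other direction of Tonelli; measurability is gained by enclosing the exceptional set in a
measurable null set. -/
theorem ae_ae_updateFinset (s : Finset V) {P : (∀ i, Ω i) → Prop}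
    (h : ∀ᵐ w ∂Measure.pi μ, P w) :
    ∀ᵐ w ∂Measure.pi μ, ∀ᵐ y ∂Measure.pi (fun i : s => μ i), P (Function.updateFinset w s y) := by
  obtain ⟨N, hN, hNm, hN0⟩ := exists_measurable_superset_of_null (ae_iff.1 h)
  have hm : Measurable (N.indicator (1 : (∀ i, Ω i) → ℝ≥0∞)) := measurable_one.indicator hNm
  have hzero : ∫⁻ w, N.indicator (1 : (∀ i, Ω i) → ℝ≥0∞) w ∂Measure.pi μ = 0 := by
    rw [lintegral_indicator_one hNm, hN0]
  have key : ∀ᵐ w ∂Measure.pi μ,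
      lmarginal μ s (N.indicator (1 : (∀ i, Ω i) → ℝ≥0∞)) w = 0 := by
    refine ae_of_forall_ae_updateFinset sᶜ (hm.lmarginal μ (measurableSet_singleton 0)) fun w => ?_
    have h0 := lmarginal_lmarginal_compl (μ := μ) hm sᶜ w
    rw [hzero, compl_compl] at h0
    exact (lintegral_eq_zero_iff ((hm.lmarginal μ).comp measurable_updateFinset)).1 h0
  filter_upwards [key] with w hw
  have h0 := (lintegral_eq_zero_iff (hm.comp measurable_updateFinset)).1 hw
  filter_upwards [h0] with y hy
  by_contra hP
  have hyN : Function.updateFinset w s y ∈ N := hN hP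
  simp [hyN] at hy

theorem lmarginal_congr_ae (s : Finset V) {f g : (∀ i, Ω i) → ℝ≥0∞}
    (h : ∀ᵐ w ∂Measure.pi μ, f w = g w) :
    ∀ᵐ w ∂Measure.pi μ, lmarginal μ s f w = lmarginal μ s g w := by
  filter_upwards [ae_ae_updateFinset s h] with w hw
  exact lintegral_congr_ae hw

theorem marginalDensity_ne_top {f : (∀ i, Ω i) → ℝ≥0∞} (hf : Measurable f)
    (h : ∫⁻ w, f w ∂Measure.pi μ ≠ ∞) (S : Finset V) :
    ∀ᵐ w ∂Measure.pi μ, marginalDensity μ f S w ≠ ∞ := by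
  refine ae_of_forall_ae_updateFinset S
    ((measurable_marginalDensity hf S (measurableSet_singleton ∞)).compl) fun w => ?_
  have h0 := lmarginal_lmarginal_compl (μ := μ) hf S w
  rw [← h0] at h
  filter_upwards [ae_lt_top ((hf.lmarginal μ).comp measurable_updateFinset) h] with y hy
  exact hy.ne

theorem marginalDensity_ne_zero {f : (∀ i, Ω i) → ℝ≥0∞} (hf : Measurable f)
    (h : ∫⁻ w, f w ∂Measure.pi μ ≠ 0) (hpos : ∀ᵐ w ∂Measure.pi μ, 0 < f w) (S : Finset V) :
    ∀ᵐ w ∂Measure.pi μ, marginalDensity μ f S w ≠ 0 := by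
  filter_upwards [ae_ae_updateFinset Sᶜ hpos] with w hw h0
  have h1 := (lintegral_eq_zero_iff (hf.comp measurable_updateFinset)).1 h0
  -- A density that is positive and zero almost everywhere on the slice forces one of the reference
  -- measures to vanish, against the nonzero total mass.
  have h2 : ∀ᵐ y ∂Measure.pi (fun i : (Sᶜ : Finset V) => μ i), False := by
    filter_upwards [hw, h1] with y hy hy'
    exact hy.ne' hy'
  rw [ae_iff] at h2
  simp only [not_false_eq_true, Set.ofPred_true, Measure.pi_univ, Finset.prod_eq_zero_iff] at h2
  obtain ⟨i, -, hi⟩ := h2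
  refine h ?_
  have : Measure.pi μ = 0 := by
    rw [← Measure.measure_univ_eq_zero, Measure.pi_univ]
    exact Finset.prod_eq_zero (Finset.mem_univ (i : V)) hi
  rw [this, lintegral_zero_measure]

theorem marginalDensity_congr_ae {f g : (∀ i, Ω i) → ℝ≥0∞}
    (h : ∀ᵐ w ∂Measure.pi μ, f w = g w) (S : Finset V) :
    ∀ᵐ w ∂Measure.pi μ, marginalDensity μ f S w = marginalDensity μ g S w :=
  lmarginal_congr_ae _ h

theorem CondIndepDensity.congr_ae {f g : (∀ i, Ω i) → ℝ≥0∞}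
    (h : ∀ᵐ w ∂Measure.pi μ, f w = g w) {A B C : Finset V} (hf : CondIndepDensity μ f A B C) :
    CondIndepDensity μ g A B C := by
  filter_upwards [hf, marginalDensity_congr_ae h (A ∪ B ∪ C), marginalDensity_congr_ae h C,
    marginalDensity_congr_ae h (A ∪ C), marginalDensity_congr_ae h (B ∪ C)] with w h0 h1 h2 h3 h4
  rwa [h1, h2, h3, h4] at h0

/-! ### Conditional independence from a factorization -/

/-- No coordinate of `C` is integrated out, so the integrated coordinates outside `U` do not occur
in `φ` and those in `U` do not occur in `ψ`. -/
theorem marginalDensity_eq_mul {p φ ψ : (∀ i, Ω i) → ℝ≥0∞} (hp : Measurable p)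
    (hφ : Measurable φ) (hψ : Measurable ψ) {W U C S : Finset V}
    (hφU : DependsOn φ (U ∪ C : Set V)) (hψU : DependsOn ψ (U : Set V)ᶜ)
    (hW : ∀ w, marginalDensity μ p W w = φ w * ψ w) (hCS : C ⊆ S) (hSW : S ⊆ W) (w : ∀ i, Ω i) :
    marginalDensity μ p S w =
      lmarginal μ ((W \ S) ∩ U) φ w * lmarginal μ ((W \ S) \ U) ψ w := by
  have hW' : marginalDensity μ p W = fun w => φ w * ψ w := funext hW
  have hm : Measurable fun w => φ w * ψ w := hφ.mul hψ
  rw [← lmarginal_marginalDensity hp hSW, hW',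
    lmarginal_eq_lmarginal_sdiff Finset.inter_subset_left hm, Finset.sdiff_inter_self_left]
  have h1 : lmarginal μ ((W \ S) \ U) (fun w => φ w * ψ w) =
      fun w => lmarginal μ ((W \ S) \ U) ψ w * φ w := by
    funext w
    rw [lmarginal_mul_left hψ hφU, mul_comm]
    intro i hi
    simp only [Finset.mem_sdiff] at hi
    rintro (h | h)
    · exact hi.2 h
    · exact hi.1.2 (hCS h)
  rw [h1, lmarginal_mul_left hφ (dependsOn_lmarginal hψU), mul_comm]
  intro i hi
  simp only [Finset.mem_inter] at hi
  exact fun h => h.1 hi.2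

/-- In the split form of the four marginals, `A` affects only the integral of `φ` and `B` only that
of `ψ`. Both sides thus have the same four factors. -/
theorem condIndepDensity_of_eq_mul {p φ ψ : (∀ i, Ω i) → ℝ≥0∞} (hp : Measurable p)
    (hφ : Measurable φ) (hψ : Measurable ψ) {W U A B C : Finset V}
    (hφU : DependsOn φ (U ∪ C : Set V)) (hψU : DependsOn ψ (U : Set V)ᶜ)
    (hW : ∀ w, marginalDensity μ p W w = φ w * ψ w) (hABC : A ∪ B ∪ C ⊆ W)
    (hA : A ⊆ U) (hB : Disjoint B U) : CondIndepDensity μ p A B C := by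
  refine Filter.Eventually.of_forall fun w => ?_
  have key : ∀ S, C ⊆ S → S ⊆ W → marginalDensity μ p S w =
      lmarginal μ ((W \ S) ∩ U) φ w * lmarginal μ ((W \ S) \ U) ψ w :=
    fun S h1 h2 => marginalDensity_eq_mul hp hφ hψ hφU hψU hW h1 h2 w
  have e1 : (W \ (A ∪ B ∪ C)) ∩ U = (W \ (A ∪ C)) ∩ U := by
    ext i
    have : i ∈ B → i ∉ U := fun h => Finset.disjoint_left.1 hB h
    simp only [Finset.mem_inter, Finset.mem_sdiff, Finset.mem_union]
    tauto
  have e2 : (W \ (A ∪ B ∪ C)) \ U = (W \ (B ∪ C)) \ U := by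
    ext i
    have := @hA i
    simp only [Finset.mem_sdiff, Finset.mem_union]
    tauto
  have e3 : (W \ (A ∪ C)) \ U = (W \ C) \ U := by
    ext i
    have := @hA i
    simp only [Finset.mem_sdiff, Finset.mem_union]
    tauto
  have e4 : (W \ (B ∪ C)) ∩ U = (W \ C) ∩ U := by
    ext i
    have : i ∈ B → i ∉ U := fun h => Finset.disjoint_left.1 hB h
    simp only [Finset.mem_inter, Finset.mem_sdiff, Finset.mem_union]
    tauto
  have hAC : A ∪ C ⊆ W := (Finset.union_subset_union_left Finset.subset_union_left).trans hABC
  have hBC : B ∪ C ⊆ W := (Finset.union_subset_union_left Finset.subset_union_right).trans hABC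
  rw [key _ Finset.subset_union_right hABC, key C subset_rfl (Finset.subset_union_right.trans hAC),
    key _ Finset.subset_union_right hAC, key _ Finset.subset_union_right hBC, e1, e2, e3, e4]
  ring

/-! ### Densities that factorize along a graph -/

/-- `k i` is a density of the variable `i` given its parents. -/
structure DAG.IsKernelFamily (D : DAG V) (μ : ∀ i, Measure (Ω i))
    (k : V → (∀ i, Ω i) → ℝ≥0∞) : Prop where
  measurable : ∀ i, Measurable (k i)
  dependsOn : ∀ i, DependsOn (k i) (insert i {j | D.Adj j i})
  lmarginal_eq_one : ∀ i w, lmarginal μ {i} (k i) w = 1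

namespace DAG.IsKernelFamily

variable {D : DAG V} {k : V → (∀ i, Ω i) → ℝ≥0∞}

theorem measurable_prod (hk : D.IsKernelFamily μ k) (B : Finset V) :
    Measurable fun w => ∏ i ∈ B, k i w :=
  Finset.measurable_fun_prod B fun i _ => hk.measurable i

/-- Integrate out a most downstream node of `A` first: it occurs in its own kernel only, which
integrates to one. -/
theorem lmarginal_prod (hk : D.IsKernelFamily μ k) (A B : Finset V) (hAB : A ⊆ B)
    (h : ∀ i ∈ A, ∀ j ∈ B, D.Adj i j → j ∈ A) :
    lmarginal μ A (fun w => ∏ i ∈ B, k i w) = fun w => ∏ i ∈ B \ A, k i w := by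
  induction hn : A.card generalizing A B with
  | zero =>
    rw [Finset.card_eq_zero] at hn
    subst hn
    simp
  | succ n ih =>
    have hwf : WellFounded (Function.swap (Relation.TransGen D.Adj)) := by
      have : Std.Irrefl (Function.swap (Relation.TransGen D.Adj)) := ⟨D.acyclic⟩
      have : IsTrans V (Function.swap (Relation.TransGen D.Adj)) :=
        ⟨fun _ _ _ h h' => h'.trans h⟩
      exact Finite.wellFounded_of_trans_of_irrefl _
    obtain ⟨i, hi, hmax⟩ := hwf.has_min (A : Set V)
      (Finset.coe_nonempty.2 (Finset.card_pos.1 (by omega)))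
    have hi : i ∈ A := hi
    have hsink : ∀ j ∈ B, ¬ D.Adj i j := fun j hj hij => hmax j (h i hi j hj hij) (.single hij)
    have hA : A = A.erase i ∪ {i} := by
      rw [Finset.union_comm, ← Finset.insert_eq, Finset.insert_erase hi]
    have hinner : lmarginal μ {i} (fun w => ∏ j ∈ B, k j w) = fun w => ∏ j ∈ B.erase i, k j w := by
      funext w
      have : (fun w => ∏ j ∈ B, k j w) = fun w => (∏ j ∈ B.erase i, k j w) * k i w :=
        funext fun w => (Finset.prod_erase_mul B (fun j => k j w) (hAB hi)).symm
      rw [this, lmarginal_mul_left (A := {i}ᶜ) (hk.measurable i), hk.lmarginal_eq_one, mul_one]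
      · intro w w' hw
        refine Finset.prod_congr rfl fun j hj => hk.dependsOn j fun m hm => hw m ?_
        rw [Finset.mem_erase] at hj
        rintro rfl
        rcases hm with hm | hm
        · exact hj.1 hm.symm
        · exact hsink j hj.2 hm
      · simp
    conv_lhs => rw [hA]
    rw [lmarginal_union μ _ (hk.measurable_prod B) (by simp), hinner,
      ih (A.erase i) (B.erase i) (Finset.erase_subset_erase i hAB) _
        (by rw [Finset.card_erase_of_mem hi, hn]; rfl)]
    · funext w
      congr 1
      ext j
      simp only [Finset.mem_sdiff, Finset.mem_erase]
      have : j = i → j ∈ A := fun h => h ▸ hi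
      tauto
    · intro m hm j hj hmj
      rw [Finset.mem_erase] at hm hj ⊢
      exact ⟨hj.1, h m hm.2 j hj.2 hmj⟩

theorem marginalDensity_prod (hk : D.IsKernelFamily μ k) (W : Finset V)
    (hW : ∀ i j, D.Adj i j → j ∈ W → i ∈ W) :
    marginalDensity μ (fun w => ∏ i, k i w) W = fun w => ∏ i ∈ W, k i w := by
  unfold marginalDensity
  rw [hk.lmarginal_prod _ _ (Finset.subset_univ _)]
  · simp
  · intro i hi j _ hij
    rw [Finset.mem_compl] at hi ⊢
    exact fun hj => hi (hW i j hij hj)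

open Classical in
/-- The global Markov property. -/
theorem condIndepDensity (hk : D.IsKernelFamily μ k) {A B C : Finset V} (hAC : Disjoint A C)
    (h : ∀ a ∈ A, ∀ b ∈ B,
      ¬ MoralConn D.Adj (ancestralSet D.Adj (A ∪ B ∪ C : Set V)) C a b) :
    CondIndepDensity μ (fun w => ∏ i, k i w) A B C := by
  set W₀ := ancestralSet D.Adj (A ∪ B ∪ C : Set V) with hW₀
  set W : Finset V := Finset.univ.filter (· ∈ W₀) with hW
  set U : Finset V := Finset.univ.filter
    (fun i => i ∈ W₀ ∧ i ∉ C ∧ ∃ a ∈ A, MoralConn D.Adj W₀ C a i) with hU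
  have memW : ∀ i, i ∈ W ↔ i ∈ W₀ := by simp [hW]
  have memU : ∀ i, i ∈ U ↔ i ∈ W₀ ∧ i ∉ C ∧ ∃ a ∈ A, MoralConn D.Adj W₀ C a i := by simp [hU]
  have hanc : ∀ i j, D.Adj i j → j ∈ W₀ → i ∈ W₀ := fun i j => mem_ancestralSet_of_rel
  have hsub : (A ∪ B ∪ C : Set V) ⊆ W₀ := subset_ancestralSet _ _
  have hfam : ∀ i ∈ W, ∀ m, m ∈ insert i {j | D.Adj j i} → m ∈ W₀ := by
    rintro i hi m (rfl | hm)
    · exact (memW _).1 hi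
    · exact hanc _ _ hm ((memW _).1 hi)
  -- A node and its parents form a clique of the moral graph, so outside `C` they lie entirely in
  -- `U` or entirely off it. Hence each kernel belongs to one of two factors.
  have hclique : ∀ i ∈ W, ∀ m, m ∈ insert i {j | D.Adj j i} → ∀ n, n ∈ insert i {j | D.Adj j i} →
      m ∈ U → n ∉ C → n ∈ U := by
    intro i hi m hm n hn hmU hnC
    have hmW := hfam i hi m hm
    have hnW := hfam i hi n hn
    obtain ⟨-, hmC, a, ha, ham⟩ := (memU m).1 hmU
    refine (memU n).2 ⟨hnW, hnC, a, ha, ?_⟩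
    rcases hm with rfl | hm <;> rcases hn with rfl | hn
    · exact ham
    · exact .tail ham ⟨⟨hmW, hmC⟩, ⟨hnW, hnC⟩, Or.inr (Or.inl hn)⟩
    · exact .tail ham ⟨⟨hmW, hmC⟩, ⟨hnW, hnC⟩, Or.inl hm⟩
    · exact .tail ham ⟨⟨hmW, hmC⟩, ⟨hnW, hnC⟩, Or.inr (Or.inr ⟨i, (memW i).1 hi, hm, hn⟩)⟩
  refine condIndepDensity_of_eq_mul (W := W) (U := U)
    (φ := fun w => ∏ i ∈ W.filter (fun i => ∃ m ∈ U, m ∈ insert i {j | D.Adj j i}), k i w)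
    (ψ := fun w => ∏ i ∈ W.filter (fun i => ¬ ∃ m ∈ U, m ∈ insert i {j | D.Adj j i}), k i w)
    (hk.measurable_prod _) (hk.measurable_prod _) (hk.measurable_prod _) ?_ ?_ ?_ ?_ ?_ ?_
  · intro w w' hw
    refine Finset.prod_congr rfl fun i hi => hk.dependsOn i fun n hn => hw n ?_
    obtain ⟨hiW, m, hmU, hm⟩ := Finset.mem_filter.1 hi
    by_cases hnC : n ∈ C
    · exact Or.inr hnC
    · exact Or.inl (hclique i hiW m hm n hn hmU hnC)
  · intro w w' hw
    refine Finset.prod_congr rfl fun i hi => hk.dependsOn i fun n hn => hw n ?_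
    obtain ⟨hiW, hm⟩ := Finset.mem_filter.1 hi
    exact fun hnU => hm ⟨n, hnU, hn⟩
  · intro w
    rw [hk.marginalDensity_prod W fun i j hij hj => (memW i).2 (hanc i j hij ((memW j).1 hj)),
      Finset.prod_filter_mul_prod_filter_not]
  · intro i hi
    exact (memW i).2 (hsub (by simpa [or_assoc] using hi))
  · intro a ha
    exact (memU a).2 ⟨hsub (Or.inl (Or.inl ha)), Finset.disjoint_left.1 hAC ha, a, ha, .refl⟩
  · rw [Finset.disjoint_left]
    intro b hb hbU
    obtain ⟨-, -, a, ha, hab⟩ := (memU b).1 hbU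
    exact h a ha b hb hab

open Classical in
/-- A product of kernels has these kernels as its conditional densities. -/
theorem marginalDensity_insert_parents (hk : D.IsKernelFamily μ k) (i : V) (w : ∀ i, Ω i) :
    marginalDensity μ (fun w => ∏ i, k i w) ({i} ∪ D.parents i) w =
      k i w * marginalDensity μ (fun w => ∏ i, k i w) (D.parents i) w := by
  set W : Finset V := Finset.univ.filter (fun j => D.IsAncestor j i) with hW
  have memW : ∀ j, j ∈ W ↔ D.IsAncestor j i := by simp [hW]
  have mempa : ∀ j, j ∈ D.parents i ↔ D.Adj j i := by simp [DAG.parents]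
  have hiW : i ∈ W := (memW i).2 .refl
  have hWanc : ∀ j l, D.Adj j l → l ∈ W → j ∈ W :=
    fun j l hjl hl => (memW j).2 (.head hjl ((memW l).1 hl))
  have hWanc' : ∀ j l, D.Adj j l → l ∈ W.erase i → j ∈ W.erase i := by
    intro j l hjl hl
    rw [Finset.mem_erase] at hl ⊢
    refine ⟨?_, hWanc j l hjl hl.2⟩
    rintro rfl
    exact D.acyclic j (Relation.TransGen.head' hjl ((memW l).1 hl.2))
  have hpaW : D.parents i ⊆ W.erase i := by
    intro j hj
    have hj := (mempa j).1 hj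
    exact Finset.mem_erase.2 ⟨fun h => D.acyclic i (.single (h ▸ hj)), (memW j).2 (.single hj)⟩
  have hfamW : {i} ∪ D.parents i ⊆ W :=
    Finset.union_subset (by simpa using hiW) (hpaW.trans (Finset.erase_subset _ _))
  -- Both marginals integrate out the same coordinates, from products over two ancestral sets that
  -- differ by the kernel of `i` alone.
  have hdiff : W \ ({i} ∪ D.parents i) = W.erase i \ D.parents i := by
    ext j
    simp only [Finset.mem_sdiff, Finset.mem_union, Finset.mem_singleton, Finset.mem_erase]
    tauto
  have hm := hk.measurable_prod Finset.univ
  rw [← lmarginal_marginalDensity hm hfamW, ← lmarginal_marginalDensity hm hpaW,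
    hk.marginalDensity_prod W hWanc, hk.marginalDensity_prod _ hWanc', hdiff,
    ← lmarginal_mul_left (hk.measurable_prod _) (hk.dependsOn i)]
  · congr 1
    funext w
    exact (Finset.mul_prod_erase W (fun j => k j w) hiW).symm
  · intro j hj hj'
    rw [Finset.mem_sdiff, Finset.mem_erase] at hj
    rcases hj' with h | h
    · exact hj.1.1 h
    · exact hj.2 ((mempa j).2 h)

end DAG.IsKernelFamily

/-! ### Consistent interventional densities -/

open Classical in
theorem DAG.IsCompatible.exists_isKernelFamily {D : DAG V} {F : Finset V → (∀ i, Ω i) → ℝ≥0∞}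
    (hF : IsInterventionalFamily μ F) (hD : D.IsCompatible μ F) :
    ∃ k, D.IsKernelFamily μ k ∧ ∀ᵐ w ∂Measure.pi μ, F ∅ w = ∏ i, k i w := by
  set c : V → (∀ i, Ω i) → ℝ≥0∞ := fun i => condDensity μ (F ∅) {i} (D.parents i) with hc
  have hcm : ∀ i, Measurable (c i) := fun i =>
    (measurable_marginalDensity (hF.measurable ∅) _).div
      (measurable_marginalDensity (hF.measurable ∅) _)
  have hcd : ∀ i, DependsOn (c i) (insert i {j | D.Adj j i}) := by
    intro i w w' hw
    have h1 := dependsOn_marginalDensity (μ := μ) (F ∅) ({i} ∪ D.parents i) (x := w) (y := w')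
      fun j hj => hw j (by simpa [DAG.parents] using hj)
    have h2 := dependsOn_marginalDensity (μ := μ) (F ∅) (D.parents i) (x := w) (y := w')
      fun j hj => hw j (by right; simpa [DAG.parents] using hj)
    simp only [hc, condDensity, h1, h2]
  -- Normalization comes from intervening on all variables but `i`.
  have hc1 : ∀ i, ∀ᵐ w ∂Measure.pi μ, lmarginal μ {i} (c i) w = 1 := by
    intro i
    have h1 : ∀ᵐ w ∂Measure.pi μ, F {i}ᶜ w = c i w := by
      filter_upwards [hD {i}ᶜ] with w hw
      simpa using hw
    filter_upwards [hF.normalized {i}ᶜ, lmarginal_congr_ae {i} h1] with w h2 h3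
    rw [← h3]
    simpa using h2
  have hne : (ae (Measure.pi μ)).NeBot := by
    rw [ae_neBot]
    intro h0
    have := hF.lintegral_eq_one
    rw [h0, lintegral_zero_measure] at this
    exact zero_ne_one this
  obtain ⟨w₀, hw₀⟩ := (ae_all_iff.2 hc1).exists
  -- Where normalization fails, substitute the density at the fixed configuration `w₀`, where it
  -- holds. The test depends on the parents only, so `k i` is still a function of `i` and its
  -- parents.
  set k : V → (∀ i, Ω i) → ℝ≥0∞ := fun i w =>
    if lmarginal μ {i} (c i) w = 1 then c i w else c i (Function.update w₀ i (w i)) with hk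
  have hupd : ∀ i (w : ∀ i, Ω i) x,
      lmarginal μ {i} (c i) (Function.update w i x) = lmarginal μ {i} (c i) w :=
    fun i w x => lmarginal_update_of_mem μ (Finset.mem_singleton_self i) _ _ _
  refine ⟨k, ⟨fun i => ?_, fun i => ?_, fun i w => ?_⟩, ?_⟩
  · refine Measurable.ite ((hcm i).lmarginal μ (measurableSet_singleton 1)) (hcm i) ?_
    exact (hcm i).comp ((measurable_update w₀).comp (measurable_pi_apply i))
  · intro w w' hw
    have h1 : lmarginal μ {i} (c i) w = lmarginal μ {i} (c i) w' :=
      dependsOn_lmarginal (hcd i) fun j hj => hw j hj.1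
    simp only [hk, h1, hcd i hw, hw i (Set.mem_insert _ _)]
  · rw [lmarginal_singleton]
    simp only [hk, hupd, Function.update_self]
    split_ifs with h
    · rw [lmarginal_singleton] at h
      exact h
    · have := hw₀ i
      rw [lmarginal_singleton] at this
      exact this
  · filter_upwards [hD ∅, ae_all_iff.2 hc1] with w hw hw1
    rw [hw]
    exact Finset.prod_congr Finset.compl_empty fun i _ => (if_pos (hw1 i)).symm

theorem DAG.IsCompatible.condIndepDensity {D : DAG V} {F : Finset V → (∀ i, Ω i) → ℝ≥0∞}
    (hF : IsInterventionalFamily μ F) (hD : D.IsCompatible μ F) {A B C : Finset V}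
    (hAC : Disjoint A C)
    (h : ∀ a ∈ A, ∀ b ∈ B,
      ¬ MoralConn D.Adj (ancestralSet D.Adj (A ∪ B ∪ C : Set V)) C a b) :
    CondIndepDensity μ (F ∅) A B C := by
  obtain ⟨k, hk, hFk⟩ := hD.exists_isKernelFamily hF
  refine (hk.condIndepDensity hAC h).congr_ae ?_
  filter_upwards [hFk] with w hw
  exact hw.symm

theorem DAG.DSep.condIndepDensity {D : DAG V} {F : Finset V → (∀ i, Ω i) → ℝ≥0∞}
    (hF : IsInterventionalFamily μ F) (hD : D.IsCompatible μ F) {A B C : Finset V}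
    (hAC : Disjoint A C) (h : D.DSep A B C) : CondIndepDensity μ (F ∅) A B C :=
  hD.condIndepDensity hF hAC fun _ ha _ hb hab => h.not_moralConn ha hb hab.symm

/-! ### Shrinking an adjustment set -/

/-- The first independence gives `f(y | x, t) = f(y | x, z)`, so that only `f(t)` still involves `T
\ Z`. The second gives `f(t) / f(x, t) = f(z) / f(x, z)`, so that only `f(y, x, t)` does. Either
way, integrate over `T \ Z`. -/
theorem AdjustmentFormula.of_condIndepDensity {F : Finset V → (∀ i, Ω i) → ℝ≥0∞}
    (hF : IsInterventionalFamily μ F) {X Y T Z : Finset V} (hXT : Disjoint X T)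
    (hYT : Disjoint Y T) (hZT : Z ⊆ T)
    (h : CondIndepDensity μ (F ∅) Y T (Z ∪ X) ∨ CondIndepDensity μ (F ∅) X T Z)
    (hT : AdjustmentFormula μ F X Y T) : AdjustmentFormula μ F X Y Z := by
  set f := F ∅ with hf
  have hfm : Measurable f := hF.measurable ∅
  have hm : ∀ S, Measurable (marginalDensity μ f S) := fun S => measurable_marginalDensity hfm S
  have h0 : ∀ S, ∀ᵐ w ∂Measure.pi μ, marginalDensity μ f S w ≠ 0 := fun S =>
    marginalDensity_ne_zero hfm (by rw [hF.lintegral_eq_one]; simp) hF.pos S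
  have hfin : ∀ S, ∀ᵐ w ∂Measure.pi μ, marginalDensity μ f S w ≠ ∞ := fun S =>
    marginalDensity_ne_top hfm (by rw [hF.lintegral_eq_one]; simp) S
  have hcm : ∀ A B, Measurable (condDensity μ f A B) := fun A B => (hm _).div (hm _)
  have hcd : ∀ A B : Finset V, DependsOn (condDensity μ f A B) (A ∪ B : Set V) := by
    intro A B w w' hw
    have h1 := dependsOn_marginalDensity (μ := μ) f (A ∪ B) (x := w) (y := w')
      fun j hj => hw j (by simpa using hj)
    have h2 := dependsOn_marginalDensity (μ := μ) f B (x := w) (y := w')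
      fun j hj => hw j (Or.inr hj)
    simp only [condDensity, h1, h2]
  have hXZT : ∀ i ∈ T \ Z, i ∉ (Y ∪ (X ∪ Z) : Set V) := by
    intro i hi
    rw [Finset.mem_sdiff] at hi
    rintro (h | h | h)
    · exact Finset.disjoint_left.1 hYT h hi.1
    · exact Finset.disjoint_left.1 hXT h hi.1
    · exact hi.2 h
  have key : ∀ᵐ w ∂Measure.pi μ,
      lmarginal μ T (fun w' => condDensity μ f Y (X ∪ T) w' * marginalDensity μ f T w') w =
        lmarginal μ Z (fun w' => condDensity μ f Y (X ∪ Z) w' * marginalDensity μ f Z w') w := by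
    rcases h with h | h
    · have e1 : ∀ᵐ w ∂Measure.pi μ,
          condDensity μ f Y (X ∪ T) w * marginalDensity μ f T w =
            condDensity μ f Y (X ∪ Z) w * marginalDensity μ f T w := by
        have s1 : Y ∪ T ∪ (Z ∪ X) = Y ∪ (X ∪ T) := by
          ext i
          have := @hZT i
          simp only [Finset.mem_union]
          tauto
        have s2 : T ∪ (Z ∪ X) = X ∪ T := by
          ext i
          have := @hZT i
          simp only [Finset.mem_union]
          tauto
        rw [CondIndepDensity, s1, s2, Finset.union_comm Z X] at h
        filter_upwards [h, h0 (X ∪ T), h0 (X ∪ Z), hfin (X ∪ T), hfin (X ∪ Z)] with w h a1 a2 b1 b2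
        congr 1
        unfold condDensity
        rw [ENNReal.div_eq_div_iff a2 b2 a1 b1, mul_comm, h, mul_comm]
      have e2 : lmarginal μ T (fun w => condDensity μ f Y (X ∪ Z) w * marginalDensity μ f T w) =
          lmarginal μ Z
            (fun w' => condDensity μ f Y (X ∪ Z) w' * marginalDensity μ f Z w') := by
        have hmm : Measurable fun w => condDensity μ f Y (X ∪ Z) w * marginalDensity μ f T w :=
          (hcm _ _).mul (hm _)
        rw [lmarginal_eq_lmarginal_sdiff hZT hmm]
        congr 1
        funext w
        rw [lmarginal_mul_left (hm T) (hcd Y (X ∪ Z)) (by simpa using hXZT),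
          lmarginal_marginalDensity hfm hZT]
      rw [← e2]
      exact lmarginal_congr_ae T e1
    · have e1 : ∀ᵐ w ∂Measure.pi μ,
          condDensity μ f Y (X ∪ T) w * marginalDensity μ f T w =
            marginalDensity μ f Z w / marginalDensity μ f (X ∪ Z) w *
              marginalDensity μ f (Y ∪ (X ∪ T)) w := by
        have s1 : X ∪ T ∪ Z = X ∪ T := by
          rw [Finset.union_assoc, Finset.union_eq_left.2 hZT]
        have s2 : T ∪ Z = T := Finset.union_eq_left.2 hZT
        rw [CondIndepDensity, s1, s2] at h
        filter_upwards [h, h0 (X ∪ T), h0 (X ∪ Z), hfin (X ∪ T), hfin (X ∪ Z)] with w h a1 a2 b1 b2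
        unfold condDensity
        have : marginalDensity μ f T w / marginalDensity μ f (X ∪ T) w =
            marginalDensity μ f Z w / marginalDensity μ f (X ∪ Z) w := by
          rw [ENNReal.div_eq_div_iff a2 b2 a1 b1, ← h]
        rw [← this, div_eq_mul_inv, div_eq_mul_inv]
        ring
      have e2 : lmarginal μ T (fun w => marginalDensity μ f Z w / marginalDensity μ f (X ∪ Z) w *
              marginalDensity μ f (Y ∪ (X ∪ T)) w) =
          lmarginal μ Z
            (fun w' => condDensity μ f Y (X ∪ Z) w' * marginalDensity μ f Z w') := by
        have hmm : Measurable fun w => marginalDensity μ f Z w / marginalDensity μ f (X ∪ Z) w *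
            marginalDensity μ f (Y ∪ (X ∪ T)) w := ((hm _).div (hm _)).mul (hm _)
        rw [lmarginal_eq_lmarginal_sdiff hZT hmm]
        congr 1
        funext w
        have hd : DependsOn (fun w => marginalDensity μ f Z w / marginalDensity μ f (X ∪ Z) w)
            (Y ∪ (X ∪ Z) : Set V) := by
          intro w w' hw
          have h1 := dependsOn_marginalDensity (μ := μ) f (X ∪ Z) (x := w) (y := w')
            fun j hj => hw j (by right; simpa using hj)
          have h2 := dependsOn_marginalDensity (μ := μ) f Z (x := w) (y := w')
            fun j hj => hw j (Or.inr (Or.inr hj))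
          simp only [h1, h2]
        have hsd : T \ Z = (Y ∪ (X ∪ T)) \ (Y ∪ (X ∪ Z)) := by
          ext i
          have h1 : i ∈ T → i ∉ X := fun h => Finset.disjoint_right.1 hXT h
          have h2 : i ∈ T → i ∉ Y := fun h => Finset.disjoint_right.1 hYT h
          simp only [Finset.mem_sdiff, Finset.mem_union]
          tauto
        rw [lmarginal_mul_left (hm _) hd hXZT, hsd,
          lmarginal_marginalDensity hfm (by gcongr)]
        unfold condDensity
        rw [div_eq_mul_inv, div_eq_mul_inv]
        ring
      rw [← e2]
      exact lmarginal_congr_ae T e1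
  filter_upwards [hT, key] with w h1 h2
  rw [h1, h2]

end Marginals

/-! ### The adjustment formula for products of kernels -/

section KernelModels

variable {V : Type v} [Fintype V] [DecidableEq V] {Ω : V → Type u}
  [∀ i, MeasurableSpace (Ω i)] {μ : ∀ i, Measure (Ω i)} [∀ i, SigmaFinite (μ i)]
  {D : DAG V} {k : V → (∀ i, Ω i) → ℝ≥0∞}

theorem DAG.IsKernelFamily.isInterventionalFamily [Nonempty (∀ i, Ω i)]
    (hk : D.IsKernelFamily μ k) (hpos : ∀ i w, 0 < k i w) :
    IsInterventionalFamily μ fun S w => ∏ i ∈ Sᶜ, k i w where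
  measurable S := hk.measurable_prod _
  lintegral_eq_one := by
    obtain ⟨w⟩ := ‹Nonempty (∀ i, Ω i)›
    rw [lintegral_eq_lmarginal_univ w, hk.lmarginal_prod _ _ (by simp) (by simp)]
    simp
  normalized S := by
    refine Filter.Eventually.of_forall fun w => ?_
    rw [hk.lmarginal_prod _ _ subset_rfl fun _ _ _ hj _ => hj]
    simp
  pos := Filter.Eventually.of_forall fun w =>
    pos_iff_ne_zero.2 (Finset.prod_ne_zero_iff.2 fun i _ => (hpos i w).ne')

theorem DAG.IsKernelFamily.isCompatible [Nonempty (∀ i, Ω i)]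
    (hk : D.IsKernelFamily μ k) (hpos : ∀ i w, 0 < k i w) :
    D.IsCompatible μ fun S w => ∏ i ∈ Sᶜ, k i w := by
  have hF := hk.isInterventionalFamily hpos
  have h1 : ∫⁻ w, ∏ i, k i w ∂Measure.pi μ = 1 := by simpa using hF.lintegral_eq_one
  have hpos' : ∀ᵐ w ∂Measure.pi μ, 0 < ∏ i, k i w := by simpa using hF.pos
  have h0 : ∀ᵐ w ∂Measure.pi μ, ∀ i, marginalDensity μ (fun w => ∏ i, k i w) (D.parents i) w ≠ 0 :=
    ae_all_iff.2 fun i => marginalDensity_ne_zero (hk.measurable_prod _) (by simp [h1]) hpos' _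
  have htop : ∀ᵐ w ∂Measure.pi μ, ∀ i,
      marginalDensity μ (fun w => ∏ i, k i w) (D.parents i) w ≠ ∞ :=
    ae_all_iff.2 fun i => marginalDensity_ne_top (hk.measurable_prod _) (by simp [h1]) _
  intro S
  filter_upwards [h0, htop] with w h0 htop
  refine Finset.prod_congr rfl fun i _ => ?_
  simp only [condDensity, Finset.compl_empty]
  rw [hk.marginalDensity_insert_parents, ENNReal.mul_div_cancel_right (h0 i) (htop i)]

/-- If the treatment has no effect on other variables in a model, then the right-hand side of
the adjustment formula does not depend on it. -/
theorem DAG.IsKernelFamily.exists_adjustment_eq [Nonempty (∀ i, Ω i)]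
    (hk : D.IsKernelFamily μ k) (hpos : ∀ i w, 0 < k i w) {x y : V} {Z : Finset V}
    (hZ : IsAdjustmentSet.{v, u} D {x} {y} Z) (hx : ∀ i ≠ x, DependsOn (k i) {x}ᶜ) :
    ∃ L : (∀ i, Ω i) → ℝ≥0∞, DependsOn L {x}ᶜ ∧ ∀ᵐ w ∂Measure.pi μ, L w =
      lmarginal μ Z (fun w' => condDensity μ (fun w => ∏ i, k i w) {y} ({x} ∪ Z) w' *
        marginalDensity μ (fun w => ∏ i, k i w) Z w') w := by
  -- This is the interventional side of the formula: intervening removes the kernel of `x`, and the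
  -- others ignore `x`.
  refine ⟨lmarginal μ ({x} ∪ {y})ᶜ (fun w => ∏ i ∈ {x}ᶜ, k i w), ?_, ?_⟩
  · have h : DependsOn (fun w => ∏ i ∈ {x}ᶜ, k i w) {x}ᶜ := fun w w' hw =>
      Finset.prod_congr rfl fun i hi => hx i (by simpa using hi) hw
    exact fun w w' hw => dependsOn_lmarginal h fun i hi => hw i hi.1
  · have := hZ.2.2.2 Ω μ _ (hk.isInterventionalFamily hpos) (hk.isCompatible hpos)
    simpa [AdjustmentFormula] using this

end KernelModels

/-! ### Finite models -/

section FiniteModels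

variable {V : Type v} [Fintype V] [DecidableEq V] {A : Type u} [Fintype A] [DecidableEq A]

/-- The configurations that agree with `w` on `S`. -/
def agreeing (S : Finset V) (w : V → A) : Finset (V → A) :=
  Finset.univ.filter fun w' => ∀ i ∈ S, w' i = w i

/-- The probability of agreeing with `w` on `S`. -/
def marginalProb (p : (V → A) → ℝ) (S : Finset V) (w : V → A) : ℝ :=
  ∑ w' ∈ agreeing S w, p w'

/-- The adjustment `∑ z, p(y | x, z) p(z)`. -/
noncomputable def adjustedProb (p : (V → A) → ℝ) (x y : V) (Z : Finset V) (w : V → A) : ℝ :=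
  ∑ w' ∈ agreeing Zᶜ w,
    marginalProb p ({y} ∪ ({x} ∪ Z)) w' / marginalProb p ({x} ∪ Z) w' * marginalProb p Z w'

theorem self_mem_agreeing (S : Finset V) (w : V → A) : w ∈ agreeing S w := by simp [agreeing]

theorem marginalProb_nonneg {p : (V → A) → ℝ} (hp : ∀ w, 0 ≤ p w) (S : Finset V) (w : V → A) :
    0 ≤ marginalProb p S w := Finset.sum_nonneg fun w _ => hp w

theorem marginalProb_pos {p : (V → A) → ℝ} (hp : ∀ w, 0 < p w) (S : Finset V) (w : V → A) :
    0 < marginalProb p S w := Finset.sum_pos (fun w _ => hp w) ⟨w, self_mem_agreeing S w⟩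

theorem marginalProb_anti {p : (V → A) → ℝ} (hp : ∀ w, 0 ≤ p w) {S S' : Finset V} (h : S ⊆ S')
    (w : V → A) : marginalProb p S' w ≤ marginalProb p S w := by
  refine Finset.sum_le_sum_of_subset_of_nonneg ?_ fun w _ _ => hp w
  intro w' hw'
  simp only [agreeing, Finset.mem_filter, Finset.mem_univ, true_and] at hw' ⊢
  exact fun i hi => hw' i (h hi)

variable [MeasurableSpace A] [MeasurableSingletonClass A]

theorem lmarginal_count (s : Finset V) (f : (V → A) → ℝ≥0∞) (w : V → A) :
    lmarginal (fun _ : V => (Measure.count : Measure A)) s f w = ∑ w' ∈ agreeing sᶜ w, f w' := by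
  unfold lmarginal
  rw [lintegral_fintype]
  simp only [Measure.pi_singleton, Measure.count_singleton, Finset.prod_const_one, mul_one]
  refine Finset.sum_nbij' (fun y => Function.updateFinset w s y) (fun w' i => w' i) ?_ ?_ ?_ ?_ ?_
  · intro y _
    simp only [agreeing, Finset.mem_filter, Finset.mem_univ, true_and, Finset.mem_compl]
    intro i hi
    simp [Function.updateFinset, hi]
  · simp
  · intro y _
    funext i
    simp [Function.updateFinset]
  · intro w' hw'
    simp only [agreeing, Finset.mem_filter, Finset.mem_univ, true_and, Finset.mem_compl] at hw'
    funext i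
    by_cases hi : i ∈ s
    · simp [Function.updateFinset, hi]
    · simp [Function.updateFinset, hi, hw' i hi]
  · simp

theorem ae_pi_count_iff {P : (V → A) → Prop} :
    (∀ᵐ w ∂Measure.pi (fun _ : V => (Measure.count : Measure A)), P w) ↔ ∀ w, P w := by
  refine ⟨fun h w => ?_, Filter.Eventually.of_forall⟩
  by_contra hw
  have h1 : Measure.pi (fun _ : V => (Measure.count : Measure A)) {w} = 0 :=
    measure_mono_null (by simpa using hw) (ae_iff.1 h)
  simp at h1

theorem marginalDensity_count {p : (V → A) → ℝ} (hp : ∀ w, 0 ≤ p w) (S : Finset V) (w : V → A) :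
    marginalDensity (fun _ : V => (Measure.count : Measure A)) (fun w => ENNReal.ofReal (p w)) S w =
      ENNReal.ofReal (marginalProb p S w) := by
  rw [marginalDensity, lmarginal_count, compl_compl, marginalProb,
    ENNReal.ofReal_sum_of_nonneg fun w _ => hp w]

theorem lmarginal_condDensity_count {p : (V → A) → ℝ} (hp : ∀ w, 0 < p w) (x y : V) (Z : Finset V)
    (w : V → A) :
    lmarginal (fun _ : V => (Measure.count : Measure A)) Z
      (fun w' => condDensity (fun _ : V => (Measure.count : Measure A))
          (fun w => ENNReal.ofReal (p w)) {y} ({x} ∪ Z) w' *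
        marginalDensity (fun _ : V => (Measure.count : Measure A))
          (fun w => ENNReal.ofReal (p w)) Z w') w = ENNReal.ofReal (adjustedProb p x y Z w) := by
  have h0 : ∀ w, 0 ≤ p w := fun w => (hp w).le
  rw [lmarginal_count, adjustedProb, ENNReal.ofReal_sum_of_nonneg]
  · refine Finset.sum_congr rfl fun w' _ => ?_
    rw [condDensity, marginalDensity_count h0, marginalDensity_count h0, marginalDensity_count h0,
      ENNReal.ofReal_mul (div_nonneg (marginalProb_nonneg h0 _ _) (marginalProb_nonneg h0 _ _)),
      ENNReal.ofReal_div_of_pos (marginalProb_pos hp _ _)]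
  · exact fun w' _ => mul_nonneg
      (div_nonneg (marginalProb_nonneg h0 _ _) (marginalProb_nonneg h0 _ _))
      (marginalProb_nonneg h0 _ _)

variable {D : DAG V} {κ : V → (V → A) → ℝ}

theorem adjustedProb_update_of_pos {x y : V} {Z : Finset V} (hZ : IsAdjustmentSet.{v, u} D {x} {y} Z)
    (hpos : ∀ i w, 0 < κ i w) (hdep : ∀ i, DependsOn (κ i) (insert i {j | D.Adj j i}))
    (hsum : ∀ i w, ∑ a, κ i (Function.update w i a) = 1) (hx : ∀ i ≠ x, DependsOn (κ i) {x}ᶜ)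
    (w : V → A) (a : A) :
    adjustedProb (fun w => ∏ i, κ i w) x y Z (Function.update w x a) =
      adjustedProb (fun w => ∏ i, κ i w) x y Z w := by
  have : Nonempty (V → A) := ⟨w⟩
  have hk : D.IsKernelFamily (fun _ : V => (Measure.count : Measure A))
      (fun i w => ENNReal.ofReal (κ i w)) := by
    refine ⟨fun i => measurable_of_finite _, fun i w w' hw => by rw [hdep i hw], fun i w => ?_⟩
    rw [lmarginal_singleton]
    simp only [lintegral_fintype, Measure.count_singleton, mul_one]
    rw [← ENNReal.ofReal_sum_of_nonneg fun a _ => (hpos i _).le, hsum, ENNReal.ofReal_one]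
  obtain ⟨L, hL, h⟩ := hk.exists_adjustment_eq (fun i w => by simpa using hpos i w) hZ
    (fun i hi w w' hw => by rw [hx i hi hw])
  rw [ae_pi_count_iff] at h
  have hp : ∀ w, 0 < ∏ i, κ i w := fun w => Finset.prod_pos fun i _ => hpos i w
  have hprod : (fun w => ∏ i, ENNReal.ofReal (κ i w)) = fun w => ENNReal.ofReal (∏ i, κ i w) :=
    funext fun w => (ENNReal.ofReal_prod_of_nonneg fun i _ => (hpos i w).le).symm
  simp only [hprod, lmarginal_condDensity_count hp] at h
  have hnn : ∀ w, 0 ≤ adjustedProb (fun w => ∏ i, κ i w) x y Z w := fun w =>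
    Finset.sum_nonneg fun w' _ => mul_nonneg
      (div_nonneg (marginalProb_nonneg (fun w => (hp w).le) _ _)
        (marginalProb_nonneg (fun w => (hp w).le) _ _))
      (marginalProb_nonneg (fun w => (hp w).le) _ _)
  rw [← ENNReal.ofReal_eq_ofReal_iff (hnn _) (hnn _), ← h, ← h]
  refine hL fun i hi => ?_
  rw [Function.update_of_ne (by simpa using hi)]

theorem tendsto_adjustedProb {p : ℝ → (V → A) → ℝ} (hp : ∀ w, Continuous fun ε => p ε w)
    (hnn : ∀ ε ∈ Set.Ioo (0 : ℝ) 1, ∀ w, 0 ≤ p ε w) (x y : V) (Z : Finset V)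
    (w : V → A)
    (h0 : ∀ w' ∈ agreeing Zᶜ w, marginalProb (p 0) ({x} ∪ Z) w' = 0 → marginalProb (p 0) Z w' = 0) :
    Filter.Tendsto (fun ε => adjustedProb (p ε) x y Z w) (nhdsWithin 0 (Set.Ioi 0))
      (nhds (adjustedProb (p 0) x y Z w)) := by
  have hm : ∀ S w, Filter.Tendsto (fun ε => marginalProb (p ε) S w) (nhdsWithin 0 (Set.Ioi 0))
      (nhds (marginalProb (p 0) S w)) := fun S w =>
    ((continuous_finsetSum _ fun w' _ => hp w').tendsto 0).mono_left nhdsWithin_le_nhds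
  refine tendsto_finsetSum _ fun w' hw' => ?_
  by_cases hb : marginalProb (p 0) ({x} ∪ Z) w' = 0
  -- The limiting conditional probability is undefined here, but it stays in `[0, 1]` while its
  -- weight tends to zero.
  · rw [h0 w' hw' hb, mul_zero]
    have hlim := hm Z w'
    rw [h0 w' hw' hb] at hlim
    have hIoo : Set.Ioo (0 : ℝ) 1 ∈ nhdsWithin (0 : ℝ) (Set.Ioi 0) := Ioo_mem_nhdsGT one_pos
    refine tendsto_of_tendsto_of_tendsto_of_le_of_le' tendsto_const_nhds hlim ?_ ?_
    · filter_upwards [hIoo] with ε hε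
      have := marginalProb_nonneg (hnn ε hε)
      exact mul_nonneg (div_nonneg (this _ _) (this _ _)) (this _ _)
    · filter_upwards [hIoo] with ε hε
      have := marginalProb_nonneg (hnn ε hε)
      exact mul_le_of_le_one_left (this _ _)
        (div_le_one_of_le₀ (marginalProb_anti (hnn ε hε) Finset.subset_union_right w') (this _ _))
  · exact ((hm _ w').div (hm _ w') hb).mul (hm _ w')

/-- For a finite model in which the treatment has no effect on other variables, the adjustment
over an adjustment set does not depend on the treatment. The density may have zeros. -/
theorem adjustedProb_update {x y : V} {Z : Finset V} (hZ : IsAdjustmentSet.{v, u} D {x} {y} Z)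
    (hnn : ∀ i w, 0 ≤ κ i w) (hdep : ∀ i, DependsOn (κ i) (insert i {j | D.Adj j i}))
    (hsum : ∀ i w, ∑ a, κ i (Function.update w i a) = 1) (hx : ∀ i ≠ x, DependsOn (κ i) {x}ᶜ)
    (w : V → A) (a : A)
    (h0 : ∀ w', w' x = w x ∨ w' x = a → marginalProb (fun w => ∏ i, κ i w) ({x} ∪ Z) w' = 0 →
      marginalProb (fun w => ∏ i, κ i w) Z w' = 0) :
    adjustedProb (fun w => ∏ i, κ i w) x y Z (Function.update w x a) =
      adjustedProb (fun w => ∏ i, κ i w) x y Z w := by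
  have hcard : (0 : ℝ) < Fintype.card A := by
    have : Nonempty A := ⟨a⟩
    exact_mod_cast Fintype.card_pos
  -- Mixing with the uniform law makes the kernels positive and preserves their normalization and
  -- their arguments.
  set κ' : ℝ → V → (V → A) → ℝ := fun ε i w => (1 - ε) * κ i w + ε / Fintype.card A with hκ'
  have hκ'pos : ∀ ε ∈ Set.Ioo (0 : ℝ) 1, ∀ i w, 0 < κ' ε i w := fun ε hε i w =>
    add_pos_of_nonneg_of_pos (mul_nonneg (by linarith [hε.2]) (hnn i w)) (div_pos hε.1 hcard)
  have hκ'0 : (fun w => ∏ i, κ i w) = fun w => ∏ i, κ' 0 i w := by simp [hκ']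
  have hxZ : x ∈ Zᶜ := Finset.mem_compl.2 (Finset.disjoint_singleton_left.1 hZ.2.1)
  have hlim : ∀ w₁ : V → A, w₁ x = w x ∨ w₁ x = a →
      Filter.Tendsto (fun ε => adjustedProb (fun w => ∏ i, κ' ε i w) x y Z w₁)
        (nhdsWithin 0 (Set.Ioi 0)) (nhds (adjustedProb (fun w => ∏ i, κ i w) x y Z w₁)) := by
    intro w₁ hw₁
    rw [hκ'0] at h0 ⊢
    refine tendsto_adjustedProb (p := fun ε w => ∏ i, κ' ε i w) (fun w => ?_)
      (fun ε hε w => Finset.prod_nonneg fun i _ => (hκ'pos ε hε i w).le) x y Z w₁ fun w' hw' => ?_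
    · simp only [hκ']
      fun_prop
    · refine h0 w' ?_
      simp only [agreeing, Finset.mem_filter, Finset.mem_univ, true_and] at hw'
      rwa [hw' x hxZ]
  refine tendsto_nhds_unique_of_eventuallyEq (hlim _ (by simp)) (hlim w (Or.inl rfl)) ?_
  filter_upwards [Ioo_mem_nhdsGT (one_pos : (0 : ℝ) < 1)] with ε hε
  refine adjustedProb_update_of_pos hZ (hκ'pos ε hε) (fun i w w' hw => ?_) (fun i w => ?_)
    (fun i hi w w' hw => ?_) w a
  · simp only [hκ', hdep i hw]
  · simp only [hκ', Finset.sum_add_distrib, ← Finset.mul_sum, hsum, Finset.sum_const,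
      Finset.card_univ, nsmul_eq_mul]
    field_simp
    ring
  · simp only [hκ', hx i hi hw]

end FiniteModels

/-! ### The signal model -/

section SignalModel

variable {V : Type v}

/-- The sign of a bit. -/
def bitSign (b : Bool) : ℝ := if b then -1 else 1

/-- The probability of a bit. -/
noncomputable def bitProb (b : Bool) : ℝ := if b then 1 / 4 else 3 / 4

theorem bitSign_xor (a b : Bool) : bitSign (a ^^ b) = bitSign a * bitSign b := by
  cases a <;> cases b <;> simp [bitSign]

theorem bitSign_mul_self (a : Bool) : bitSign a * bitSign a = 1 := by
  cases a <;> simp [bitSign]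

theorem bitProb_pos (b : Bool) : 0 < bitProb b := by
  cases b <;> norm_num [bitProb]

namespace DAG

variable (D : DAG V) (x : V) (Z : Set V) (r₀ : V)

open Classical in
/-- The signal of `r` reaches `i` through unobserved parents, in the configuration `w`. -/
noncomputable def received (w : V → V → V → Bool) (i r : V) : Bool :=
  decide (∃ p, D.Adj p i ∧ p ∉ insert x Z ∧ w p r r = true)

open Classical in
/-- The structural equations of the signal model. Unobserved nodes transmit all signals that they
receive, and their own. An element of `Z` shows, for any two signals visible to it, whether they
are equal, and `x` shows the signal of `r₀`. -/
noncomputable def signalEqn (i : V) (w : V → V → V → Bool) (b : Bool) : V → V → Bool :=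
  if i = x then fun _ _ => D.received x Z w i r₀
  else if i ∈ Z then fun r r' =>
    if (r ∉ insert x Z ∧ D.Visible (insert x Z) i r) ∧
        (r' ∉ insert x Z ∧ D.Visible (insert x Z) i r')
      then D.received x Z w i r ^^ D.received x Z w i r' else false
  else fun r _ => if r = i then b else D.received x Z w i r

open Classical in
/-- The solution of the structural equations for the signals `e`. -/
noncomputable def signalSol (e : V → Bool) (i : V) : V → V → Bool :=
  if i = x then fun _ _ => e r₀
  else if i ∈ Z then fun r r' =>
    if (r ∉ insert x Z ∧ D.Visible (insert x Z) i r) ∧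
        (r' ∉ insert x Z ∧ D.Visible (insert x Z) i r')
      then e r ^^ e r' else false
  else fun r _ => if r ∉ insert x Z ∧ D.Carries (insert x Z) r i then e r else false

variable {D x Z r₀}

theorem Carries.notMem {N : Set V} {r i : V} (h : D.Carries N r i) (hr : r ∉ N) : i ∉ N := by
  cases h with
  | refl => exact hr
  | tail _ h => exact h.2

-- Parents that carry `r` all show the same bit and the other unobserved parents show `false`, so
-- the disjunction in `received` returns that bit.
open Classical in
theorem received_signalSol (e : V → Bool) (i r : V) :
    D.received x Z (D.signalSol x Z r₀ e) i r =
      if r ∉ insert x Z ∧ D.Visible (insert x Z) i r then e r else false := by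
  have h : ∀ p ∉ insert x Z, D.signalSol x Z r₀ e p r r =
      if r ∉ insert x Z ∧ D.Carries (insert x Z) r p then e r else false := by
    intro p hp
    have h1 : p ≠ x := fun h => hp (h ▸ Set.mem_insert _ _)
    have h2 : p ∉ Z := fun h => hp (Set.mem_insert_of_mem _ h)
    simp only [signalSol, h1, h2, if_false]
  unfold received
  split_ifs with hr
  · obtain ⟨hr, p, hpi, hrp⟩ := hr
    cases her : e r
    · simp only [decide_eq_false_iff_not]
      rintro ⟨q, -, hq, hw⟩
      rw [h q hq, her] at hw
      simp at hw
    · simp only [decide_eq_true_eq]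
      exact ⟨p, hpi, hrp.notMem hr, by rw [h p (hrp.notMem hr), if_pos ⟨hr, hrp⟩, her]⟩
  · simp only [decide_eq_false_iff_not]
    rintro ⟨p, hpi, hp, hw⟩
    rw [h p hp] at hw
    split_ifs at hw with hc
    exact hr ⟨hc.1, p, hpi, hc.2⟩

open Classical in
theorem signalEqn_signalSol (hr₀ : r₀ ∉ insert x Z) (hv : D.Visible (insert x Z) x r₀)
    (e : V → Bool) (i : V) :
    D.signalEqn x Z r₀ i (D.signalSol x Z r₀ e) (e i) = D.signalSol x Z r₀ e i := by
  unfold signalEqn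
  simp only [received_signalSol]
  unfold signalSol
  by_cases h1 : i = x
  · subst h1
    simp only [hr₀, hv, not_false_eq_true, and_self, if_true]
  by_cases h2 : i ∈ Z
  · simp only [h1, h2, if_true, if_false]
    funext r r'
    by_cases h3 : (r ∉ insert x Z ∧ D.Visible (insert x Z) i r) ∧
        (r' ∉ insert x Z ∧ D.Visible (insert x Z) i r')
    · rw [if_pos h3, if_pos h3, if_pos h3.1, if_pos h3.2]
    · rw [if_neg h3, if_neg h3]
  · have hi : i ∉ insert x Z := by
      rintro (h | h)
      exacts [h1 h, h2 h]
    simp only [h1, h2, if_false]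
    funext r r'
    by_cases hri : r = i
    · subst hri
      have : D.Carries (insert x Z) r r := .refl
      simp [hi, this]
    · have hiff : D.Carries (insert x Z) r i ↔ D.Visible (insert x Z) i r := by
        constructor
        · intro h
          cases h with
          | refl => exact absurd rfl hri
          | tail h h' => exact ⟨_, h'.1, h⟩
        · rintro ⟨p, hpi, hp⟩
          exact .tail hp ⟨hpi, hi⟩
      rw [if_neg hri]
      exact if_congr (by rw [hiff]) rfl rfl

/-- The equations read unobserved parents only. In particular, `x` has no effect on other variables.
-/
theorem signalEqn_congr {w w' : V → V → V → Bool} {i : V}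
    (h : ∀ p, D.Adj p i → p ∉ insert x Z → w p = w' p) (b : Bool) :
    D.signalEqn x Z r₀ i w b = D.signalEqn x Z r₀ i w' b := by
  have : ∀ r, D.received x Z w i r = D.received x Z w' i r := by
    intro r
    unfold received
    refine decide_eq_decide.2 (exists_congr fun p => and_congr_right fun h1 => and_congr_right fun h2 => ?_)
    rw [h p h1 h2]
  unfold signalEqn
  simp only [this]

theorem eq_signalEqn_iff [Finite V] (hr₀ : r₀ ∉ insert x Z) (hv : D.Visible (insert x Z) x r₀)
    (e : V → Bool) (w : V → V → V → Bool) :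
    (∀ i, w i = D.signalEqn x Z r₀ i w (e i)) ↔ w = D.signalSol x Z r₀ e := by
  constructor
  · intro h
    funext i
    induction i using D.wellFounded_adj.induction with
    | _ i ih =>
      rw [h i, signalEqn_congr (fun p hp _ => ih p hp) (e i), signalEqn_signalSol hr₀ hv]
  · rintro rfl i
    exact (signalEqn_signalSol hr₀ hv e i).symm

theorem signalSol_self (e : V → Bool) : D.signalSol x Z r₀ e x = fun _ _ => e r₀ := by
  simp [signalSol]

/-- Flipping all signals does not change what `Z` shows. -/
theorem signalSol_not (hx : x ∉ Z) (e : V → Bool) {z : V} (hz : z ∈ Z) :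
    D.signalSol x Z r₀ (fun i => !e i) z = D.signalSol x Z r₀ e z := by
  have : z ≠ x := fun h => hx (h ▸ hz)
  simp [signalSol, this, hz]

/-- The product of two linked signals is a function of what `Z` shows. -/
theorem exists_bitSign_eq_mul (hx : x ∉ Z) {r : V}
    (h : Relation.ReflTransGen (D.Linked (insert x Z) Z) r₀ r) :
    ∃ ψ : (V → V → V → Bool) → ℝ, DependsOn ψ Z ∧
      ∀ e, bitSign (e r) = bitSign (e r₀) * ψ (D.signalSol x Z r₀ e) := by
  induction h with
  | refl => exact ⟨fun _ => 1, fun _ _ _ => rfl, fun e => (mul_one _).symm⟩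
  | @tail r r' _ h ih =>
    obtain ⟨ψ, hψ, h1⟩ := ih
    obtain ⟨hr, hr', z, hz, hzr, hzr'⟩ := h
    have hzx : z ≠ x := fun h => hx (h ▸ hz)
    refine ⟨fun w => ψ w * bitSign (w z r r'), fun w w' hw => ?_, fun e => ?_⟩
    · change ψ w * bitSign (w z r r') = ψ w' * bitSign (w' z r r')
      rw [hψ hw, hw z hz]
    · have h2 : D.signalSol x Z r₀ e z r r' = (e r ^^ e r') := by
        simp only [signalSol, hzx, hz, if_true, if_false]
        rw [if_pos ⟨⟨hr, hzr⟩, ⟨hr', hzr'⟩⟩]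
      change _ = _ * (_ * bitSign (D.signalSol x Z r₀ e z r r'))
      rw [h2, bitSign_xor, ← mul_assoc, ← h1, ← mul_assoc, bitSign_mul_self, one_mul]

end DAG

/-! ### The law of the signal model -/

variable [Fintype V] [DecidableEq V]

theorem sum_prod_bit (g : V → Bool → ℝ) :
    ∑ e : V → Bool, ∏ i, g i (e i) = ∏ i, (g i true + g i false) := by
  have := Finset.prod_univ_sum (fun _ : V => (Finset.univ : Finset Bool)) g
  rw [Fintype.piFinset_univ] at this
  rw [← this]
  simp

/-- The product of two signals has a positive mean. -/
theorem sum_prod_bitProb_mul_pos (r r' : V) :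
    0 < ∑ e : V → Bool, (∏ i, bitProb (e i)) * (bitSign (e r) * bitSign (e r')) := by
  have h : ∀ e : V → Bool, (∏ i, bitProb (e i)) * (bitSign (e r) * bitSign (e r')) =
      ∏ i, bitProb (e i) *
        ((if i = r then bitSign (e i) else 1) * (if i = r' then bitSign (e i) else 1)) := by
    intro e
    rw [Finset.prod_mul_distrib, Finset.prod_mul_distrib]
    simp
  simp only [h]
  rw [sum_prod_bit fun i b => bitProb b *
        ((if i = r then bitSign b else 1) * (if i = r' then bitSign b else 1))]
  refine Finset.prod_pos fun i _ => ?_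
  -- A sign has mean `3 / 4 - 1 / 4 = 1 / 2` and square one; with fair bits the product would have
  -- mean zero for `r ≠ r'`.
  split_ifs <;> norm_num [bitProb, bitSign]

variable {A : Type u} [Fintype A] [DecidableEq A]

/-- Expand the product over a choice of one bit per node: all equations hold exactly at the solution
for those bits. -/
theorem prod_sum_ite_eq {D : DAG V} {x : V} {Z : Set V} {r₀ : V} (hr₀ : r₀ ∉ insert x Z)
    (hv : D.Visible (insert x Z) x r₀) (c : A ≃ (V → V → Bool)) (w : V → A) :
    ∏ i, ∑ b, bitProb b *
        (if c (w i) = D.signalEqn x Z r₀ i (fun j => c (w j)) b then (1 : ℝ) else 0) =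
      ∑ e : V → Bool, (∏ i, bitProb (e i)) *
        if (fun j => c (w j)) = D.signalSol x Z r₀ e then 1 else 0 := by
  rw [Finset.prod_univ_sum, Fintype.piFinset_univ]
  refine Finset.sum_congr rfl fun e _ => ?_
  rw [Finset.prod_mul_distrib]
  congr 1
  have h := DAG.eq_signalEqn_iff hr₀ hv e fun j => c (w j)
  by_cases hw : (fun j => c (w j)) = D.signalSol x Z r₀ e
  · rw [if_pos hw]
    exact Finset.prod_eq_one fun i _ => if_pos (h.2 hw i)
  · rw [if_neg hw]
    obtain ⟨i, hi⟩ := not_forall.1 (mt h.1 hw)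
    exact Finset.prod_eq_zero (Finset.mem_univ i) (if_neg hi)

/-- The probability of agreeing with `w` on `S` in a model with solution map `sol`. -/
theorem marginalProb_sum_ite {E : Type*} [Fintype E] (Q : E → ℝ) (sol : E → V → A) (S : Finset V)
    (w : V → A) :
    marginalProb (fun w => ∑ e, Q e * if w = sol e then 1 else 0) S w =
      ∑ e, Q e * if ∀ i ∈ S, sol e i = w i then 1 else 0 := by
  unfold marginalProb
  rw [Finset.sum_comm]
  refine Finset.sum_congr rfl fun e _ => ?_
  rw [← Finset.mul_sum]
  congr 1
  rw [Finset.sum_ite_eq']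
  simp [agreeing]

/-- Summing over the values of `Z` with their probabilities is averaging over the noise `e`, with
`Z` as `e` shows it. -/
theorem adjustedProb_sum_ite {E : Type*} [Fintype E] (Q : E → ℝ) (sol : E → V → A) (x y : V)
    (Z : Finset V) (w : V → A) :
    adjustedProb (fun w => ∑ e, Q e * if w = sol e then 1 else 0) x y Z w =
      ∑ e, Q e *
        (marginalProb (fun w => ∑ e, Q e * if w = sol e then 1 else 0) ({y} ∪ ({x} ∪ Z))
            (fun i => if i ∈ Z then sol e i else w i) /
          marginalProb (fun w => ∑ e, Q e * if w = sol e then 1 else 0) ({x} ∪ Z)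
            (fun i => if i ∈ Z then sol e i else w i)) := by
  unfold adjustedProb
  simp only [marginalProb_sum_ite _ _ Z, Finset.mul_sum]
  rw [Finset.sum_comm]
  refine Finset.sum_congr rfl fun e _ => ?_
  rw [Finset.sum_eq_single (fun i => if i ∈ Z then sol e i else w i)]
  · rw [if_pos fun i hi => by simp [hi]]
    ring
  · intro w' hw' hne
    rw [if_neg, mul_zero, mul_zero]
    intro h
    refine hne (funext fun i => ?_)
    simp only [agreeing, Finset.mem_filter, Finset.mem_univ, true_and, Finset.mem_compl] at hw'
    split_ifs with hi
    · exact (h i hi).symm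
    · exact hw' i hi
  · intro h
    refine absurd ?_ h
    simp only [agreeing, Finset.mem_filter, Finset.mem_univ, true_and, Finset.mem_compl]
    intro i hi
    rw [if_neg hi]

/-- An adjustment set separates `x` and `y` in the moral graph without the edges out of `x`. -/
theorem IsAdjustmentSet.not_moralConn {D : DAG V} {x y : V} {Z : Finset V}
    (hZ : IsAdjustmentSet.{v, u} D {x} {y} Z) :
    ¬ MoralConn (D.BackdoorAdj x) (ancestralSet (D.BackdoorAdj x) ({x, y} ∪ (Z : Set V))) Z x y := by
  intro hconn
  have hxy : x ≠ y := by simpa using hZ.1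
  have hxZ : x ∉ Z := by simpa using hZ.2.1
  have hyZ : y ∉ Z := by simpa using hZ.2.2.1
  have hyN : y ∉ insert x (Z : Set V) := by
    rintro (h | h)
    exacts [hxy h.symm, hyZ h]
  obtain ⟨r, ⟨r₀, hr₀, hv, hlink⟩, hry⟩ := DAG.exists_linkedTo_carries hxy hconn
  have hr : r ∉ insert x (Z : Set V) := DAG.LinkedTo.notMem ⟨r₀, hr₀, hv, hlink⟩
  obtain ⟨ψ, hψ, hbit⟩ := DAG.exists_bitSign_eq_mul (x := x) (Z := (Z : Set V)) (by simpa) hlink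
  -- The natural value space `V → V → Bool` lives in the universe of `V`; a copy in the universe of
  -- the value spaces is needed.
  let A : Type u := ULift.{u} (Fin (Fintype.card (V → V → Bool)))
  let c : A ≃ (V → V → Bool) := Equiv.ulift.trans (Fintype.equivFin _).symm
  let _ : MeasurableSpace A := ⊤
  have _ : MeasurableSingletonClass A := ⟨fun _ => trivial⟩
  let Q : (V → Bool) → ℝ := fun e => ∏ i, bitProb (e i)
  let sol : (V → Bool) → V → A := fun e i => c.symm (D.signalSol x Z r₀ e i)
  let p : (V → A) → ℝ := fun w => ∑ e, Q e * if w = sol e then 1 else 0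
  let κ : V → (V → A) → ℝ := fun i w => ∑ b, bitProb b *
    (if c (w i) = D.signalEqn x Z r₀ i (fun j => c (w j)) b then (1 : ℝ) else 0)
  have hQ : ∀ e, 0 < Q e := fun e => Finset.prod_pos fun i _ => bitProb_pos _
  have hp : (fun w => ∏ i, κ i w) = p := by
    funext w
    refine (prod_sum_ite_eq hr₀ hv c w).trans (Finset.sum_congr rfl fun e _ => ?_)
    congr 2
    refine propext ⟨fun h => funext fun i => ?_, ?_⟩
    · simp only [sol, ← h, Equiv.symm_apply_apply]
    · rintro rfl
      simp [sol]
  -- the chance of seeing a value at `x` is positive given what `Z` shows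
  have hshow : ∀ (e : V → Bool) (b : Bool) (w : V → A), (∀ i ∈ Z, sol e i = w i) →
      c (w x) = (fun _ _ => b) → 0 < marginalProb p ({x} ∪ Z) w := by
    intro e b w hwZ hwx
    obtain ⟨e', he'Z, he'b⟩ : ∃ e', (∀ i ∈ Z, sol e' i = w i) ∧ e' r₀ = b := by
      by_cases h : e r₀ = b
      · exact ⟨e, hwZ, h⟩
      -- Flipping all signals changes what `x` shows but leaves `Z` as it is.
      · refine ⟨fun i => !e i, fun i hi => ?_, by simp [Bool.eq_not_of_ne h]⟩
        rw [← hwZ i hi]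
        simp only [sol]
        rw [DAG.signalSol_not (by simpa) e (by simpa using hi)]
    have hterm : ∀ i ∈ {x} ∪ Z, sol e' i = w i := by
      intro i hi
      rcases Finset.mem_union.1 hi with hi | hi
      · rw [Finset.mem_singleton] at hi
        subst hi
        simp only [sol, DAG.signalSol_self, he'b, ← hwx, Equiv.symm_apply_apply]
      · exact he'Z i hi
    simp only [p, marginalProb_sum_ite]
    refine Finset.sum_pos' (fun e _ => mul_nonneg (hQ e).le (by split_ifs <;> norm_num))
      ⟨e', Finset.mem_univ _, ?_⟩
    rw [if_pos hterm, mul_one]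
    exact hQ e'
  have hinv : ∀ (w : V → A) (b b' : Bool), c (w x) = (fun _ _ => b) →
      adjustedProb p x y Z (Function.update w x (c.symm fun _ _ => b')) =
        adjustedProb p x y Z w := by
    intro w b b' hwb
    rw [← hp]
    refine adjustedProb_update (D := D) hZ (fun i w => ?_) (fun i w w' hw => ?_) (fun i w => ?_)
      (fun i hi w w' hw => ?_) w _ fun w' hw' h0 => ?_
    · exact Finset.sum_nonneg fun b _ => mul_nonneg (bitProb_pos b).le (by split_ifs <;> norm_num)
    · refine Finset.sum_congr rfl fun b _ => ?_
      rw [hw i (Set.mem_insert _ _), DAG.signalEqn_congr (w' := fun j => c (w' j))]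
      exact fun j hj _ => by rw [hw j (Or.inr hj)]
    · simp only [κ]
      rw [Finset.sum_comm]
      have : ∀ b, ∑ a : A, bitProb b * (if c (Function.update w i a i) =
          D.signalEqn x Z r₀ i (fun j => c (Function.update w i a j)) b then (1 : ℝ) else 0) =
            bitProb b := by
        intro b
        have h1 : ∀ a, D.signalEqn x Z r₀ i (fun j => c (Function.update w i a j)) b =
            D.signalEqn x Z r₀ i (fun j => c (w j)) b := fun a => by
          refine DAG.signalEqn_congr (fun j hj _ => ?_) b
          rw [Function.update_of_ne]
          rintro rfl
          exact D.acyclic j (.single hj)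
        rw [← Finset.mul_sum]
        simp only [h1, Function.update_self, ← Equiv.eq_symm_apply]
        simp
      simp only [this, Fintype.sum_bool]
      norm_num [bitProb]
    · refine Finset.sum_congr rfl fun b _ => ?_
      rw [hw i hi, DAG.signalEqn_congr (w' := fun j => c (w' j))]
      intro j _ hj
      rw [hw j fun h => hj (Or.inl h)]
    · rw [hp] at h0 ⊢
      have hb : ∃ b, c (w' x) = fun _ _ => b := by
        rcases hw' with h | h
        · exact ⟨b, by rw [h, hwb]⟩
        · exact ⟨b', by rw [h, Equiv.apply_symm_apply]⟩
      obtain ⟨b, hb⟩ := hb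
      simp only [p, marginalProb_sum_ite]
      refine Finset.sum_eq_zero fun e _ => ?_
      rw [if_neg, mul_zero]
      intro h
      exact (hshow e b w' h hb).ne' h0
  -- the mean of the sign of the signal at `y`
  have hmean : ∀ (w : V → A) (b : Bool), c (w x) = (fun _ _ => b) →
      ∑ a : A, bitSign (c a r r) * adjustedProb p x y Z (Function.update w y a) =
        bitSign b * ∑ e, Q e * (bitSign (e r₀) * bitSign (e r)) := by
    intro w b hwb
    -- Given `x` and `Z`, the sign of `r` read off at `y` is determined: it is that of `b` times
    -- `ψ`.
    have hcond : ∀ w : V → A, c (w x) = (fun _ _ => b) →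
        ∑ a : A, bitSign (c a r r) * marginalProb p ({y} ∪ ({x} ∪ Z)) (Function.update w y a) =
          bitSign b * ψ (fun i => c (w i)) * marginalProb p ({x} ∪ Z) w := by
      intro w hwb
      simp only [p, marginalProb_sum_ite, Finset.mul_sum]
      rw [Finset.sum_comm]
      refine Finset.sum_congr rfl fun e _ => ?_
      have hy : c (sol e y) r r = e r := by
        simp only [sol, Equiv.apply_symm_apply, DAG.signalSol, hxy.symm, if_false]
        rw [if_neg (by simpa using hyZ), if_pos ⟨hr, hry⟩]
      have hiff : ∀ a, (∀ i ∈ {y} ∪ ({x} ∪ Z), sol e i = Function.update w y a i) ↔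
          a = sol e y ∧ ∀ i ∈ {x} ∪ Z, sol e i = w i := by
        intro a
        have hne : ∀ i ∈ {x} ∪ Z, i ≠ y := by
          rintro i hi rfl
          exact hyN (by simpa using hi)
        constructor
        · intro h
          refine ⟨by simpa using (h y (by simp)).symm, fun i hi => ?_⟩
          rw [h i (Finset.mem_union_right _ hi), Function.update_of_ne (hne i hi)]
        · rintro ⟨rfl, h⟩ i hi
          by_cases hiy : i = y
          · subst hiy
            simp
          · rw [Function.update_of_ne hiy]
            exact h i ((Finset.mem_union.1 hi).resolve_left (by simpa using hiy))
      simp only [hiff]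
      by_cases hag : ∀ i ∈ {x} ∪ Z, sol e i = w i
      · have h1 : e r₀ = b := by
          have := congrArg c (hag x (by simp))
          rw [hwb] at this
          simp only [sol, DAG.signalSol_self, Equiv.apply_symm_apply] at this
          exact congrFun (congrFun this x) x
        have h2 : ψ (D.signalSol x Z r₀ e) = ψ (fun i => c (w i)) := hψ fun i hi => by
          rw [← hag i (Finset.mem_union_right _ hi)]
          simp [sol]
        rw [Finset.sum_eq_single (sol e y), if_pos ⟨rfl, hag⟩, if_pos hag, hy, hbit, h1, h2]
        · intro a _ ha
          rw [if_neg fun h => ha h.1, mul_zero, mul_zero]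
        · simp
      · rw [if_neg hag, mul_zero, mul_zero]
        exact Finset.sum_eq_zero fun a _ => by rw [if_neg fun h => hag h.2, mul_zero, mul_zero]
    simp only [p, adjustedProb_sum_ite, Finset.mul_sum]
    rw [Finset.sum_comm]
    refine Finset.sum_congr rfl fun e _ => ?_
    set w₁ : V → A := fun i => if i ∈ Z then sol e i else w i with hw₁
    have hupd : ∀ a, (fun i => if i ∈ Z then sol e i else Function.update w y a i) =
        Function.update w₁ y a := by
      intro a
      funext i
      by_cases hiy : i = y
      · subst hiy
        simp [hyZ]
      · simp [Function.update_of_ne hiy, hw₁]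
    have hw₁x : c (w₁ x) = fun _ _ => b := by simp only [hw₁, hxZ, if_false, hwb]
    have hw₁Z : ∀ i ∈ Z, sol e i = w₁ i := fun i hi => by simp [hw₁, hi]
    have hden : ∀ a, marginalProb p ({x} ∪ Z) (Function.update w₁ y a) =
        marginalProb p ({x} ∪ Z) w₁ := by
      intro a
      unfold marginalProb
      congr 1
      unfold agreeing
      congr 1
      funext w'
      refine propext (forall_congr' fun i => imp_congr_right fun hi => ?_)
      rw [Function.update_of_ne]
      rintro rfl
      exact hyN (by simpa using hi)
    have hψ₁ : ψ (fun i => c (w₁ i)) = ψ (D.signalSol x Z r₀ e) := hψ fun i hi => by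
      rw [← hw₁Z i hi]
      simp [sol]
    have hpos := hshow e b w₁ hw₁Z hw₁x
    have hc := hcond w₁ hw₁x
    simp only [hupd]
    calc ∑ a, bitSign (c a r r) * (Q e * (marginalProb p ({y} ∪ ({x} ∪ Z)) (Function.update w₁ y a) /
            marginalProb p ({x} ∪ Z) (Function.update w₁ y a)))
        = Q e * ((∑ a, bitSign (c a r r) *
            marginalProb p ({y} ∪ ({x} ∪ Z)) (Function.update w₁ y a)) /
              marginalProb p ({x} ∪ Z) w₁) := by
          simp only [hden, Finset.sum_div, Finset.mul_sum]
          exact Finset.sum_congr rfl fun a _ => by ring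
      _ = bitSign b * (Q e * (bitSign (e r₀) * bitSign (e r))) := by
          rw [hc, mul_div_assoc, div_self hpos.ne', hψ₁, hbit e, ← mul_assoc (bitSign (e r₀)),
            bitSign_mul_self]
          ring
  -- The two values at `x` give adjusted means of opposite sign and positive size, although
  -- adjustment ignores the value at `x`.
  have hK := sum_prod_bitProb_mul_pos r₀ r
  let w : V → A := fun _ => c.symm fun _ _ => false
  have h1 := hmean w false (by simp [w])
  have h2 := hmean (Function.update w x (c.symm fun _ _ => true)) true (by simp)
  have h3 : ∀ a, adjustedProb p x y Z
      (Function.update (Function.update w x (c.symm fun _ _ => true)) y a) =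
        adjustedProb p x y Z (Function.update w y a) := by
    intro a
    rw [Function.update_comm hxy]
    refine hinv _ false true ?_
    rw [Function.update_of_ne hxy]
    simp [w]
  simp only [h3] at h2
  rw [h1] at h2
  simp only [bitSign, if_true, Bool.false_eq_true, if_false] at h2
  have hK' : 0 < ∑ e, Q e * (bitSign (e r₀) * bitSign (e r)) := hK
  simp only [bitSign] at hK'
  linarith

end SignalModel

/-! ### Criteria for minimality -/

section Minimality

variable {V : Type v} [Fintype V] [DecidableEq V] {Ω : V → Type u}
  [∀ i, MeasurableSpace (Ω i)] {μ : ∀ i, Measure (Ω i)} [∀ i, SigmaFinite (μ i)]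

theorem condIndepDensity_congr_right {f : (∀ i, Ω i) → ℝ≥0∞} {A B B' C : Finset V}
    (h : B ∪ C = B' ∪ C) : CondIndepDensity μ f A B C ↔ CondIndepDensity μ f A B' C := by
  simp only [CondIndepDensity, Finset.union_assoc, h]

theorem MoralConn.mono_ancestralSet {R : V → V → Prop} {S S' C C' : Set V} {i j : V}
    (hS : S ⊆ S') (hC : C' ⊆ C) (h : MoralConn R (ancestralSet R S) C i j) :
    MoralConn R (ancestralSet R S') C' i j := by
  have hW : ancestralSet R S ⊆ ancestralSet R S' := ancestralSet_mono hS
  refine h.mono fun i j ⟨hi, hj, hij⟩ =>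
    ⟨⟨hW hi.1, fun h => hi.2 (hC h)⟩, ⟨hW hj.1, fun h => hj.2 (hC h)⟩, ?_⟩
  rcases hij with h | h | ⟨s, hs, h⟩
  · exact Or.inl h
  · exact Or.inr (Or.inl h)
  · exact Or.inr (Or.inr ⟨s, hW hs, h⟩)

/-- An adjustment set may be replaced by a subset that satisfies one of the two conditional
independences under a faithful density. -/
theorem IsAdjustmentSet.of_condIndepDensity {D : DAG V} {f : (∀ i, Ω i) → ℝ≥0∞}
    (hf : D.IsFaithful μ f) {X Y T Z : Finset V} (hT : IsAdjustmentSet.{v, u} D X Y T)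
    (hZT : Z ⊆ T)
    (h : CondIndepDensity μ f Y T (Z ∪ X) ∨ CondIndepDensity μ f X T Z) :
    IsAdjustmentSet.{v, u} D X Y Z := by
  obtain ⟨hXY, hXT, hYT, hT⟩ := hT
  refine ⟨hXY, hXT.mono_right hZT, hYT.mono_right hZT, fun Ω' _ μ' _ F hF hD => ?_⟩
  refine AdjustmentFormula.of_condIndepDensity hF hXT hYT hZT ?_ (hT Ω' μ' F hF hD)
  -- Faithfulness speaks of disjoint sets, so `T` is replaced by `T \ Z`, which leaves the densities
  -- involved unchanged.
  have e1 : T ∪ (Z ∪ X) = T \ Z ∪ (Z ∪ X) := by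
    rw [← Finset.union_assoc, ← Finset.union_assoc, Finset.sdiff_union_self_eq_union]
  have e2 : T ∪ Z = T \ Z ∪ Z := Finset.sdiff_union_self_eq_union.symm
  have hYT' : Disjoint Y (T \ Z) := hYT.mono_right Finset.sdiff_subset
  have hXT' : Disjoint X (T \ Z) := hXT.mono_right Finset.sdiff_subset
  rcases h with h | h
  · have hdis : Disjoint Y (Z ∪ X) :=
      Finset.disjoint_union_right.2 ⟨hYT.mono_right hZT, hXY.symm⟩
    have hsep := hf Y (T \ Z) (Z ∪ X) hYT' hdis
      (Finset.disjoint_union_right.2 ⟨Finset.sdiff_disjoint, hXT'.symm⟩)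
      ((condIndepDensity_congr_right e1).1 h)
    exact Or.inl ((condIndepDensity_congr_right e1).2 (hsep.condIndepDensity hF hD hdis))
  · have hdis : Disjoint X Z := hXT.mono_right hZT
    have hsep := hf X (T \ Z) Z hXT' hdis Finset.sdiff_disjoint
      ((condIndepDensity_congr_right e2).1 h)
    exact Or.inr ((condIndepDensity_congr_right e2).2 (hsep.condIndepDensity hF hD hdis))

/-- Necessity of the two dependences for minimality. -/
theorem IsMinimalAdjustmentSet.not_condIndepDensity {D : DAG V} {f : (∀ i, Ω i) → ℝ≥0∞}
    (hf : D.IsFaithful μ f) {X Y : V} {T : Finset V}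
    (hT : IsMinimalAdjustmentSet.{v, u} D {X} {Y} T) {t : V} (ht : t ∈ T) :
    ¬ CondIndepDensity μ f {X} {t} (T \ {t}) ∧
      ¬ CondIndepDensity μ f {Y} {t} ((T \ {t}) ∪ {X}) := by
  have hsub : T \ {t} ⊆ T := Finset.sdiff_subset
  have hss : T \ {t} ⊂ T := Finset.sdiff_ssubset (by simpa using ht) (by simp)
  have e1 : {t} ∪ (T \ {t}) = T ∪ (T \ {t}) := by
    rw [Finset.union_sdiff_of_subset (by simpa using ht), Finset.union_eq_left.2 hsub]
  have e2 : {t} ∪ ((T \ {t}) ∪ {X}) = T ∪ ((T \ {t}) ∪ {X}) := by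
    rw [← Finset.union_assoc, ← Finset.union_assoc, e1]
  rw [condIndepDensity_congr_right e1, condIndepDensity_congr_right e2]
  exact ⟨fun h => hT.2 _ hss (hT.1.of_condIndepDensity hf hsub (Or.inr h)),
    fun h => hT.2 _ hss (hT.1.of_condIndepDensity hf hsub (Or.inl h))⟩

/-- Sufficiency of the two dependences for minimality. -/
theorem IsAdjustmentSet.isMinimalAdjustmentSet {D : DAG V}
    {F : Finset V → (∀ i, Ω i) → ℝ≥0∞} (hF : IsInterventionalFamily μ F)
    (hD : D.IsCompatible μ F) {X Y : V} {T : Finset V}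
    (hT : IsAdjustmentSet.{v, u} D {X} {Y} T) (hTX : D.Precedes T {X})
    (h : ∀ t ∈ T, ¬ CondIndepDensity μ (F ∅) {X} {t} (T \ {t}) ∧
      ¬ CondIndepDensity μ (F ∅) {Y} {t} ((T \ {t}) ∪ {X})) :
    IsMinimalAdjustmentSet.{v, u} D {X} {Y} T := by
  refine ⟨hT, fun Z hZT hZ => hZ.not_moralConn ?_⟩
  have hXY : X ≠ Y := by simpa using hT.1
  have hXT : X ∉ T := by simpa using hT.2.1
  have hYT : Y ∉ T := by simpa using hT.2.2.1
  -- Each missing connection would be an independence by the Markov property, against the assumed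
  -- dependences.
  refine MoralConn.of_ssubset (DAG.BackdoorAdj.acyclic X) (T := (T : Set V)) (by simpa) (by simpa)
    (by exact_mod_cast hZT) (fun t ht => ?_) (fun t ht => ?_) hT.not_moralConn
  · by_contra hcon
    refine (h t ht).1 (hD.condIndepDensity hF (by simp [hXT]) ?_)
    simp only [Finset.mem_singleton, forall_eq]
    intro hc
    have hc' := DAG.MoralConn.backdoorAdj_of_not_isAncestor (T := (T : Set V))
      (fun t ht => hTX t ht X (by simp))
      (hc.mono_ancestralSet (S' := {X} ∪ (T : Set V)) ?_ subset_rfl)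
    · exact hcon (hc'.mono_ancestralSet (by grind) (by simp))
    · intro i hi
      simp only [Finset.coe_singleton, Finset.coe_sdiff, Set.mem_union, Set.mem_singleton_iff,
        Set.mem_sdiff, Finset.mem_coe] at hi ⊢
      rcases hi with (rfl | rfl) | hi
      exacts [Or.inl rfl, Or.inr ht, Or.inr hi.1]
  · by_contra hcon
    refine (h t ht).2 (hD.condIndepDensity hF (by simp [hYT, hXY.symm]) ?_)
    simp only [Finset.mem_singleton, forall_eq]
    intro hc
    have hc' := DAG.MoralConn.backdoorAdj_of_mem (x := X) (by simp) (by simp) hc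
    refine hcon (hc'.mono_ancestralSet ?_ ?_)
    · intro i hi
      simp only [Finset.coe_singleton, Finset.coe_sdiff, Finset.coe_union, Set.mem_union,
        Set.mem_singleton_iff, Set.mem_sdiff, Finset.mem_coe, Set.mem_insert_iff] at hi ⊢
      rcases hi with (rfl | rfl) | hi | rfl
      exacts [Or.inl (Or.inr rfl), Or.inr ht, Or.inr hi.1, Or.inl (Or.inl rfl)]
    · simp

end Minimality

theorem lemma2 {V : Type v} [Fintype V] [DecidableEq V] {Ω : V → Type u}
    [∀ i, MeasurableSpace (Ω i)] (μ : ∀ i, Measure (Ω i)) [∀ i, SigmaFinite (μ i)]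
    (M : StructuralModel V Ω) (F : Finset V → (∀ i, Ω i) → ℝ≥0∞) (hM : M.IsCausalModel μ F)
    (X Y : V) (T : Finset V)
    (hT : IsAdjustmentSet.{v, u} M.D {X} {Y} T) (hTX : M.D.Precedes T {X}) :
    (IsMinimalAdjustmentSet.{v, u} M.D {X} {Y} T ↔
      ∀ t ∈ T, ¬ CondIndepDensity μ (F ∅) {X} {t} (T \ {t}) ∧
        ¬ CondIndepDensity μ (F ∅) {Y} {t} ((T \ {t}) ∪ {X})) ∧
    (¬ IsMinimalAdjustmentSet.{v, u} M.D {X} {Y} T →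
      ∀ Z ⊂ T,
        (∀ z ∈ Z, ¬ CondIndepDensity μ (F ∅) {X} {z} (Z \ {z}) ∧
          ¬ CondIndepDensity μ (F ∅) {Y} {z} ((Z \ {z}) ∪ {X})) →
        (CondIndepDensity μ (F ∅) {Y} T (Z ∪ {X}) ∨ CondIndepDensity μ (F ∅) {X} T Z) →
        IsMinimalAdjustmentSet.{v, u} M.D {X} {Y} Z) := by
  have hF := hM.induces.isInterventionalFamily
  refine ⟨⟨fun h t ht => h.not_condIndepDensity hM.faithful ht,
    hT.isMinimalAdjustmentSet hF hM.compatible hTX⟩, fun _ Z hZT hZ h => ?_⟩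
  exact (hT.of_condIndepDensity hM.faithful hZT.1 h).isMinimalAdjustmentSet hF hM.compatible
    (fun i hi => hTX i (hZT.1 hi)) hZ
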